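/- Let $(\mathcal D,\Sigma,\triangle)$ be a triangulated category and let $\mathbf x=(\mathcal U,\mathcal W)$ be a t-structure in $\mathcal D$, where $\mathcal U=\mathcal D^{\le 0}$ and $\mathcal W=\mathcal D^{\ge 0}$, that is, $\mathcal W=(\Sigma\,\mathcal U)^{\perp}$. For $n\ge 1$ the extended heart $\mathcal C_n:=\mathcal W\cap\Sigma^{-n+1}\mathcal U$ is closed under extensions in $\mathcal D$, and is regarded as an extriangulated category with $\mathbb E(X,A)=\mathrm{Hom}_{\mathcal D}(X,\Sigma A)$, where $\delta\in\mathbb E(X,A)$ is realized by the sequences $A\to B\to X$ in $\mathcal C_n$ for which $A\to B\to X\xrightarrow{\delta}\Sigma A$ is a distinguished triangle. Let $\mathrm{Free}(\mathcal W)$ (resp. $\mathrm{coFree}(\mathcal U)$) be the class of objects of $\mathcal D$ which are a coproduct of a family of objects of $\mathcal W$ (resp. a product of a family of objects of $\mathcal U$). For $m\ge 0$, $\mathbf x$ is called $m$-smashing if $\mathrm{Free}(\mathcal W)\subseteq\Sigma^{m}\mathcal W$, and $m$-co-smashing if $\mathrm{coFree}(\mathcal U)\subseteq\Sigma^{-m}\mathcal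 U$; smashing means $0$-smashing and co-smashing means $0$-co-smashing. An extriangulated category $(\mathcal C,\mathbb E,\mathfrak s)$ is called AET3.5 if for every non-empty set $I$ all coproducts indexed by $I$ exist in $\mathcal C$, and there is a homomorphism of abelian groups $$\Gamma:\prod_{i\in I}\mathbb E(B_i,A)\to\mathbb E\Big(\coprod_{i\in I}B_i,\,A^{(I)}\Big),$$ natural in the family $(B_i)_{i\in I}$ and in $A$, such that, whenever each $\eta_i\in\mathbb E(B_i,A)$ is realized by $A\xrightarrow{x_i}F_i\xrightarrow{y_i}B_i$, the extension $\Gamma((\eta_i)_i)$ is realized by $A^{(I)}\xrightarrow{\coprod x_i}\coprod F_i\xrightarrow{\coprod y_i}\coprod B_i$. It is called AET4 if moreover, for every non-empty set $I$, such a $\Gamma$ can be chosen with $\Gamma(\eta)\cdot\mu_i^{B}=\mu_i^{A}\cdot\eta_i$ for all $\eta=(\eta_j)_{j\in I}$ and $i\in I$, where $\mu_i^B:B_i\to\coprod_j B_j$ and $\mu_i^A:A\to A^{(I)}$ are the $i$-th inclusions. It is AET3.5* (resp. AET4*) if the opposite extriangulated category is AET3.5 (resp. AET4). **Theorem.** Let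 $n\ge 2$. 1. Assume that $\mathcal D$ has coproducts and that $\mathbf x$ is $(n-1)$-smashing. Then the following are equivalent: (a) $\mathbf x$ is smashing; (b) $\mathcal C_n$ is AET4; (c) $\mathcal C_n$ is AET3.5. 2. Dually, assume that $\mathcal D$ has products and that $\mathbf x$ is $(n-1)$-co-smashing. Then the following are equivalent: (a) $\mathbf x$ is co-smashing; (b) $\mathcal C_n$ is AET4*; (c) $\mathcal C_n$ is AET3.5*. -/

import Mathlib

open CategoryTheory Category Limits Opposite Pretriangulated Triangulated

universe w e v u

namespace Extri

/-! ### Extriangulated categories -/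

section Bifunctor

variable {𝒞 : Type u} [Category.{v} 𝒞]

/-- The group `𝔼(X, A)` of extensions of `X` by `A`. -/
abbrev ExtGroup (E : 𝒞ᵒᵖ ⥤ 𝒞 ⥤ AddCommGrpCat.{e}) (X A : 𝒞) : Type e :=
  (E.obj (op X)).obj A

/-- The action `a · δ = 𝔼(X, a)(δ)`. -/
def push {E : 𝒞ᵒᵖ ⥤ 𝒞 ⥤ AddCommGrpCat.{e}} {X A A' : 𝒞} (a : A ⟶ A') (δ : ExtGroup E X A) :
    ExtGroup E X A' :=
  ((E.obj (op X)).map a).hom δ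

/-- The action `δ · c = 𝔼(c, A)(δ)`. -/
def pull {E : 𝒞ᵒᵖ ⥤ 𝒞 ⥤ AddCommGrpCat.{e}} {X X' A : 𝒞} (c : X' ⟶ X) (δ : ExtGroup E X A) :
    ExtGroup E X' A :=
  ((E.map c.op).app A).hom δ

theorem push_pull {E : 𝒞ᵒᵖ ⥤ 𝒞 ⥤ AddCommGrpCat.{e}} {X X' A A' : 𝒞} (a : A ⟶ A') (c : X' ⟶ X)
    (δ : ExtGroup E X A) : push a (pull c δ) = pull c (push a δ) :=
  (ConcreteCategory.congr_hom ((E.map c.op).naturality a) δ).symm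

end Bifunctor

/-- An extriangulated structure (in the sense of Nakaoka and Palu) on an additive category `𝒞`:
an additive bifunctor `𝔼 : 𝒞ᵒᵖ × 𝒞 → Ab` with an additive realization satisfying the axioms
(ET3), (ET3)ᵒᵖ, (ET4) and (ET4)ᵒᵖ. -/
structure ExtriangulatedStructure (𝒞 : Type u) [Category.{v} 𝒞] [Preadditive 𝒞]
    [HasZeroObject 𝒞] [HasBinaryBiproducts 𝒞] where
  /-- the bifunctor `𝔼` -/
  E : 𝒞ᵒᵖ ⥤ 𝒞 ⥤ AddCommGrpCat.{e}
  additive_right (X : 𝒞ᵒᵖ) : (E.obj X).Additive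
  additive_left (A : 𝒞) : (E.flip.obj A).Additive
  /-- `Realizes δ x y` says that the sequence `A ⟶ B ⟶ X` given by `x` and `y` belongs to
  the equivalence class `𝔰(δ)`. -/
  Realizes {A B X : 𝒞} (δ : ExtGroup E X A) (x : A ⟶ B) (y : B ⟶ X) : Prop
  /-- Together with `realizes_iff`, this says that `𝔰(δ)` is exactly one equivalence class of
  sequences `A ⟶ B ⟶ X`, where two sequences are equivalent if there is an isomorphism between
  their middle terms which is compatible with the identities of `A` and `X`. -/
  exists_realizes {A X : 𝒞} (δ : ExtGroup E X A) :
    ∃ (B : 𝒞) (x : A ⟶ B) (y : B ⟶ X), Realizes δ x y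
  realizes_iff {A B B' X : 𝒞} (δ : ExtGroup E X A) (x : A ⟶ B) (y : B ⟶ X)
    (x' : A ⟶ B') (y' : B' ⟶ X) (h : Realizes δ x y) :
    Realizes δ x' y' ↔ ∃ b : B ≅ B', x ≫ b.hom = x' ∧ b.hom ≫ y' = y
  /-- morphisms of extensions are realized by morphisms of sequences -/
  realizes_hom {A B X A' B' X' : 𝒞} {δ : ExtGroup E X A} {x : A ⟶ B} {y : B ⟶ X}
    {δ' : ExtGroup E X' A'} {x' : A' ⟶ B'} {y' : B' ⟶ X'}
    (h : Realizes δ x y) (h' : Realizes δ' x' y')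
    (a : A ⟶ A') (c : X ⟶ X') (hac : push a δ = pull c δ') :
    ∃ b : B ⟶ B', x ≫ b = a ≫ x' ∧ y ≫ c = b ≫ y'
  /-- the realization is additive: zero extensions are realized by split sequences -/
  realizes_zero {A X : 𝒞} (b : BinaryBicone A X) (hb : b.IsBilimit) :
    Realizes (0 : ExtGroup E X A) b.inl b.snd
  /-- the realization is additive: `𝔰(δ ⊕ δ') = 𝔰(δ) ⊕ 𝔰(δ')`, for all choices of biproducts -/
  realizes_sum {A B X A' B' X' : 𝒞} {δ : ExtGroup E X A} {x : A ⟶ B} {y : B ⟶ X}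
    {δ' : ExtGroup E X' A'} {x' : A' ⟶ B'} {y' : B' ⟶ X'}
    (h : Realizes δ x y) (h' : Realizes δ' x' y')
    (bA : BinaryBicone A A') (hA : bA.IsBilimit) (bB : BinaryBicone B B') (hB : bB.IsBilimit)
    (bX : BinaryBicone X X') (hX : bX.IsBilimit) :
    Realizes (push bA.inl (pull bX.fst δ) + push bA.inr (pull bX.snd δ'))
      (bA.fst ≫ x ≫ bB.inl + bA.snd ≫ x' ≫ bB.inr)
      (bB.fst ≫ y ≫ bX.inl + bB.snd ≫ y' ≫ bX.inr)
  et3 {A B X A' B' X' : 𝒞} {δ : ExtGroup E X A} {x : A ⟶ B} {y : B ⟶ X}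
    {δ' : ExtGroup E X' A'} {x' : A' ⟶ B'} {y' : B' ⟶ X'}
    (h : Realizes δ x y) (h' : Realizes δ' x' y')
    (a : A ⟶ A') (b : B ⟶ B') (hab : x ≫ b = a ≫ x') :
    ∃ c : X ⟶ X', y ≫ c = b ≫ y' ∧ push a δ = pull c δ'
  et3op {A B X A' B' X' : 𝒞} {δ : ExtGroup E X A} {x : A ⟶ B} {y : B ⟶ X}
    {δ' : ExtGroup E X' A'} {x' : A' ⟶ B'} {y' : B' ⟶ X'}
    (h : Realizes δ x y) (h' : Realizes δ' x' y')
    (b : B ⟶ B') (c : X ⟶ X') (hbc : y ≫ c = b ≫ y') :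
    ∃ a : A ⟶ A', x ≫ b = a ≫ x' ∧ push a δ = pull c δ'
  et4 {A B C D F : 𝒞} {δ : ExtGroup E D A} {f : A ⟶ B} {f' : B ⟶ D}
    {δ' : ExtGroup E F B} {g : B ⟶ C} {g' : C ⟶ F}
    (h : Realizes δ f f') (h' : Realizes δ' g g') :
    ∃ (G : 𝒞) (k : C ⟶ G) (d : D ⟶ G) (q : G ⟶ F) (δ'' : ExtGroup E G A),
      Realizes δ'' (f ≫ g) k ∧ f' ≫ d = g ≫ k ∧ k ≫ q = g' ∧
      Realizes (push f' δ') d q ∧ pull d δ'' = δ ∧ push f δ'' = pull q δ'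
  et4op {A B C D F : 𝒞} {δ : ExtGroup E B D} {f' : D ⟶ A} {f : A ⟶ B}
    {δ' : ExtGroup E C F} {g' : F ⟶ B} {g : B ⟶ C}
    (h : Realizes δ f' f) (h' : Realizes δ' g' g) :
    ∃ (G : 𝒞) (k : G ⟶ A) (d : D ⟶ G) (q : G ⟶ F) (δ'' : ExtGroup E C G),
      Realizes δ'' k (f ≫ g) ∧ d ≫ k = f' ∧ k ≫ f = q ≫ g' ∧
      Realizes (pull g' δ) d q ∧ δ' = push q δ'' ∧ push d δ = pull g δ''

namespace ExtriangulatedStructure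

variable {𝒞 : Type u} [Category.{v} 𝒞] [Preadditive 𝒞] [HasZeroObject 𝒞] [HasBinaryBiproducts 𝒞]

/-! ### The opposite extriangulated category -/

theorem Realizes.congr {S : ExtriangulatedStructure.{e} 𝒞} {A B X : 𝒞}
    {δ δ' : ExtGroup S.E X A} {x x' : A ⟶ B} {y y' : B ⟶ X} (h : S.Realizes δ x y)
    (hδ : δ = δ') (hx : x = x') (hy : y = y') : S.Realizes δ' x' y' := by
  subst hδ hx hy
  exact h

/-- The bicone in `𝒞` corresponding to a bicone in `𝒞ᵒᵖ`. -/
@[simps]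
def unopBicone {A X : 𝒞ᵒᵖ} (b : BinaryBicone A X) : BinaryBicone A.unop X.unop where
  pt := b.pt.unop
  fst := b.inl.unop
  snd := b.inr.unop
  inl := b.fst.unop
  inr := b.snd.unop
  inl_fst := by simp [← unop_comp]
  inl_snd := by simp [← unop_comp]
  inr_fst := by simp [← unop_comp]
  inr_snd := by simp [← unop_comp]

/-- The bicone obtained by exchanging the two summands. -/
@[simps]
def swapBicone {A X : 𝒞} (b : BinaryBicone A X) : BinaryBicone X A where
  pt := b.pt
  fst := b.snd
  snd := b.fst
  inl := b.inr
  inr := b.inl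

/-- The bicone in `𝒞` corresponding to a bilimit bicone in `𝒞ᵒᵖ` is bilimit. -/
def isBilimitUnopBicone {A X : 𝒞ᵒᵖ} {b : BinaryBicone A X} (hb : b.IsBilimit) :
    (unopBicone b).IsBilimit :=
  isBinaryBilimitOfTotal _ (by
    have := congrArg Quiver.Hom.unop (IsBilimit.binary_total hb)
    simp only [unop_add, unop_comp, unop_id] at this
    exact this)

/-- Exchanging the two summands preserves bilimit bicones. -/
def isBilimitSwapBicone {A X : 𝒞} {b : BinaryBicone A X} (hb : b.IsBilimit) :
    (swapBicone b).IsBilimit :=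
  isBinaryBilimitOfTotal _ ((add_comm _ _).trans (IsBilimit.binary_total hb))

/-- The bifunctor `𝔼ᵒᵖ(X, A) = 𝔼(A, X)` on the opposite category. -/
def opBifunctor (E : 𝒞ᵒᵖ ⥤ 𝒞 ⥤ AddCommGrpCat.{e}) : 𝒞ᵒᵖᵒᵖ ⥤ 𝒞ᵒᵖ ⥤ AddCommGrpCat.{e} :=
  unopUnop 𝒞 ⋙ E.flip

/-- The opposite extriangulated category: a sequence realizes an extension in `𝒞ᵒᵖ` if and only
if the opposite sequence realizes it in `𝒞`. -/
noncomputable def op (S : ExtriangulatedStructure.{e} 𝒞) : ExtriangulatedStructure.{e} 𝒞ᵒᵖ where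
  E := opBifunctor S.E
  additive_right X := S.additive_left X.unop.unop
  additive_left A := by
    have := S.additive_right (.op A.unop)
    exact ⟨fun {X Y f g} => (S.E.obj (.op A.unop)).map_add (f := f.unop.unop) (g := g.unop.unop)⟩
  Realizes {A B X} δ x y :=
    S.Realizes (A := X.unop) (X := A.unop) δ y.unop x.unop
  exists_realizes {A X} δ := by
    obtain ⟨B, x, y, h⟩ := S.exists_realizes (A := X.unop) (X := A.unop) δ
    exact ⟨.op B, y.op, x.op, h⟩
  realizes_iff {A B B' X} δ x y x' y' h := by
    refine (S.realizes_iff (A := X.unop) (X := A.unop) δ _ _ _ _ h).trans ⟨?_, ?_⟩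
    · rintro ⟨b, h₁, h₂⟩
      exact ⟨b.op.symm, by
        rw [← Quiver.Hom.op_unop x, ← h₂]
        simp, by
        rw [← Quiver.Hom.op_unop y', ← h₁]
        simp⟩
    · rintro ⟨b, h₁, h₂⟩
      exact ⟨b.unop.symm, by
        rw [← h₂]
        simp, by
        rw [← h₁]
        simp⟩
  realizes_hom {A B X A' B' X' δ x y δ' x' y'} h h' a c hac := by
    obtain ⟨b, h₁, h₂⟩ := S.realizes_hom (A := X'.unop) (X := A'.unop) (A' := X.unop)
      (X' := A.unop) h' h c.unop a.unop hac.symm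
    exact ⟨b.op, Quiver.Hom.unop_inj h₂.symm, Quiver.Hom.unop_inj h₁.symm⟩
  realizes_zero b hb :=
    S.realizes_zero (swapBicone (unopBicone b)) (isBilimitSwapBicone (isBilimitUnopBicone hb))
  realizes_sum {A B X A' B' X' δ x y δ' x' y'} h h' bA hA bB hB bX hX := by
    exact (S.realizes_sum (A := X.unop) (X := A.unop) (A' := X'.unop) (X' := A'.unop) h h'
      _ (isBilimitUnopBicone hX) _ (isBilimitUnopBicone hB) _ (isBilimitUnopBicone hA)).congr
      (congrArg₂ (· + ·) (push_pull (E := S.E) _ _ _) (push_pull (E := S.E) _ _ _))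
      (by simp; rfl) (by simp; rfl)
  et3 {A B X A' B' X' δ x y δ' x' y'} h h' a b hab := by
    obtain ⟨c, h₁, h₂⟩ := S.et3op (A := X'.unop) (X := A'.unop) (A' := X.unop)
      (X' := A.unop) h' h b.unop a.unop (congrArg Quiver.Hom.unop hab).symm
    exact ⟨c.op, Quiver.Hom.unop_inj h₁.symm, h₂.symm⟩
  et3op {A B X A' B' X' δ x y δ' x' y'} h h' b c hbc := by
    obtain ⟨a, h₁, h₂⟩ := S.et3 (A := X'.unop) (X := A'.unop) (A' := X.unop)
      (X' := A.unop) h' h c.unop b.unop (congrArg Quiver.Hom.unop hbc).symm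
    exact ⟨a.op, Quiver.Hom.unop_inj h₁.symm, h₂.symm⟩
  et4 {A B C D F δ f f' δ' g g'} h h' := by
    obtain ⟨G, k, d, q, δ'', h₁, h₂, h₃, h₄, h₅, h₆⟩ := S.et4op h' h
    exact ⟨.op G, k.op, q.op, d.op, δ'', h₁, Quiver.Hom.unop_inj h₃.symm,
      Quiver.Hom.unop_inj h₂, h₄, h₅.symm, h₆.symm⟩
  et4op {A B C D F δ f' f δ' g' g} h h' := by
    obtain ⟨G, k, d, q, δ'', h₁, h₂, h₃, h₄, h₅, h₆⟩ := S.et4 h' h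
    exact ⟨.op G, k.op, q.op, d.op, δ'', h₁, Quiver.Hom.unop_inj h₃,
      Quiver.Hom.unop_inj h₂.symm, h₄, h₅.symm, h₆.symm⟩

/-! ### The conditions AET3, AET3.5 and AET4 -/

section AET

variable (S : ExtriangulatedStructure.{e} 𝒞)

/-- The datum showing that the functor `∐ : Fun(I, 𝒞) ⥤ 𝒞` is `(1, T)`-extriangulated, where
`T : 𝒞 ⥤ Fun(I, 𝒞)` is the constant functor and `Fun(I, 𝒞)` has the product extriangulated
structure: a transformation `Γ : ∏ 𝔼(Bᵢ, A) ⟶ 𝔼(∐ Bᵢ, A^(I))` of functors to abelian groups which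
is natural in `(Bᵢ)ᵢ` and in `A`, such that `Γ(ηᵢ)ᵢ` is realized by the coproduct of sequences
realizing the extensions `ηᵢ`. -/
structure CoproductTransformation (I : Type w) [HasColimitsOfShape (Discrete I) 𝒞] where
  Γ (B : I → 𝒞) (A : 𝒞) :
    (∀ i, ExtGroup S.E (B i) A) →+ ExtGroup S.E (∐ B) (∐ fun _ : I => A)
  naturality_left {B B' : I → 𝒞} (A : 𝒞) (f : ∀ i, B' i ⟶ B i)
    (η : ∀ i, ExtGroup S.E (B i) A) :
    Γ B' A (fun i => pull (f i) (η i)) = pull (Limits.Sigma.map f) (Γ B A η)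
  naturality_right (B : I → 𝒞) {A A' : 𝒞} (g : A ⟶ A') (η : ∀ i, ExtGroup S.E (B i) A) :
    Γ B A' (fun i => push g (η i)) = push (Limits.Sigma.map fun _ : I => g) (Γ B A η)
  realizes {B F : I → 𝒞} {A : 𝒞} (η : ∀ i, ExtGroup S.E (B i) A)
    (x : ∀ i, A ⟶ F i) (y : ∀ i, F i ⟶ B i) (h : ∀ i, S.Realizes (η i) (x i) (y i)) :
    S.Realizes (Γ B A η) (Limits.Sigma.map x) (Limits.Sigma.map y)

/-- The canonical inclusions `Xᵢ ⟶ ∐ Xᵢ` define a `(1, T)`-extriangulated natural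
transformation. -/
def CoproductTransformation.InclusionsExtriangulated {S : ExtriangulatedStructure.{e} 𝒞}
    {I : Type w} [HasColimitsOfShape (Discrete I) 𝒞] (G : S.CoproductTransformation I) : Prop :=
  ∀ (B : I → 𝒞) (A : 𝒞) (η : ∀ i, ExtGroup S.E (B i) A) (i : I),
    pull (Limits.Sigma.ι B i) (G.Γ B A η) = push (Limits.Sigma.ι (fun _ : I => A) i) (η i)

/-- AET3.5: for every non-empty set `I`, all coproducts indexed by `I` exist (that is AET3) and the
coproduct functor is `(1, T)`-extriangulated. -/
def AET35 : Prop :=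
  ∀ (I : Type w) [Nonempty I], ∃ _ : HasColimitsOfShape (Discrete I) 𝒞,
    Nonempty (S.CoproductTransformation I)

/-- AET4: moreover, the coproduct inclusions are `(1, T)`-extriangulated. -/
def AET4 : Prop :=
  ∀ (I : Type w) [Nonempty I], ∃ _ : HasColimitsOfShape (Discrete I) 𝒞,
    ∃ G : S.CoproductTransformation I, G.InclusionsExtriangulated

/-- AET3.5*: the opposite extriangulated category is AET3.5. -/
def AET35Star : Prop := AET35.{w} S.op

/-- AET4*: the opposite extriangulated category is AET4. -/
def AET4Star : Prop := AET4.{w} S.op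

end AET

end ExtriangulatedStructure

/-! ### Extension-closed subcategories of triangulated categories -/

section Triangulated

variable {D : Type u} [Category.{v} D] [Preadditive D] [HasZeroObject D] [HasShift D ℤ]
  [∀ n : ℤ, (shiftFunctor D n).Additive] [Pretriangulated D]

/-- The isomorphism between a bilimit bicone and a product of two objects. -/
noncomputable def biconeIsoPi (X : WalkingPair → D) (b : BinaryBicone (X .left) (X .right))
    (hb : b.IsBilimit) : b.pt ≅ ∏ᶜ X where
  hom := Pi.lift (fun j => match j with | .left => b.fst | .right => b.snd)
  inv := Pi.π X .left ≫ b.inl + Pi.π X .right ≫ b.inr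
  hom_inv_id := by
    simp [IsBilimit.binary_total hb]
  inv_hom_id := by
    ext (_ | _) <;> simp

theorem dist_of_iso {A B X A' B' X' : D} {x : A ⟶ B} {y : B ⟶ X} {δ : X ⟶ A⟦(1 : ℤ)⟧}
    {x' : A' ⟶ B'} {y' : B' ⟶ X'} {δ' : X' ⟶ A'⟦(1 : ℤ)⟧}
    (h : Triangle.mk x y δ ∈ distTriang D) (eA : A' ≅ A) (eB : B' ≅ B) (eX : X' ≅ X)
    (h₁ : x' ≫ eB.hom = eA.hom ≫ x) (h₂ : y' ≫ eX.hom = eB.hom ≫ y)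
    (h₃ : δ' ≫ eA.hom⟦(1 : ℤ)⟧' = eX.hom ≫ δ) : Triangle.mk x' y' δ' ∈ distTriang D :=
  isomorphic_distinguished _ h _ (Triangle.isoMk _ _ eA eB eX h₁ h₂ h₃)

theorem dist_iff_of_dist {A B B' X : D} {x : A ⟶ B} {y : B ⟶ X} {δ : X ⟶ A⟦(1 : ℤ)⟧}
    (x' : A ⟶ B') (y' : B' ⟶ X) (h : Triangle.mk x y δ ∈ distTriang D) :
    Triangle.mk x' y' δ ∈ distTriang D ↔ ∃ b : B ≅ B', x ≫ b.hom = x' ∧ b.hom ≫ y' = y := by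
  constructor
  · intro h'
    have hδ : δ ≫ (𝟙 A)⟦(1 : ℤ)⟧' = 𝟙 X ≫ δ := by simp
    obtain ⟨b, h₁, h₂⟩ := complete_distinguished_triangle_morphism₂ _ _ h h' (𝟙 A) (𝟙 X) hδ
    let φ : Triangle.mk x y δ ⟶ Triangle.mk x' y' δ := Triangle.homMk _ _ (𝟙 A) b (𝟙 X) h₁ h₂ hδ
    have : IsIso φ.hom₂ := isIso₂_of_isIso₁₃ φ h h' (inferInstanceAs (IsIso (𝟙 A)))
      (inferInstanceAs (IsIso (𝟙 X)))
    have hb : IsIso (X := B) (Y := B') b := this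
    exact ⟨asIso (X := B) (Y := B') b, h₁.trans (id_comp x'), h₂.symm.trans (comp_id y)⟩
  · rintro ⟨b, h₁, h₂⟩
    refine dist_of_iso h (Iso.refl A) b.symm (Iso.refl X) ?_ ?_ ?_
    · simp [← h₁]
    · simp [← h₂]
    · simp

theorem pi_distinguished (X₁ X₂ X₃ : WalkingPair → D) (f : ∀ j, X₁ j ⟶ X₂ j)
    (g : ∀ j, X₂ j ⟶ X₃ j) (h : ∀ j, X₃ j ⟶ (X₁ j)⟦(1 : ℤ)⟧)
    (H : ∀ j, Triangle.mk (f j) (g j) (h j) ∈ distTriang D) :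
    Triangle.mk (Limits.Pi.map f) (Limits.Pi.map g)
      (Limits.Pi.map h ≫ inv (piComparison (shiftFunctor D (1 : ℤ)) X₁)) ∈ distTriang D :=
  productTriangle_distinguished (fun j => Triangle.mk (f j) (g j) (h j)) H

theorem biconeIsoPi_hom_π_left (X : WalkingPair → D) (b : BinaryBicone (X .left) (X .right))
    (hb : b.IsBilimit) : (biconeIsoPi X b hb).hom ≫ Pi.π X .left = b.fst := by
  simp [biconeIsoPi]

theorem biconeIsoPi_hom_π_right (X : WalkingPair → D) (b : BinaryBicone (X .left) (X .right))
    (hb : b.IsBilimit) : (biconeIsoPi X b hb).hom ≫ Pi.π X .right = b.snd := by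
  simp [biconeIsoPi]

theorem family_sum_distinguished (X₁ X₂ X₃ : WalkingPair → D) (f : ∀ j, X₁ j ⟶ X₂ j)
    (g : ∀ j, X₂ j ⟶ X₃ j) (h : ∀ j, X₃ j ⟶ (X₁ j)⟦(1 : ℤ)⟧)
    (H : ∀ j, Triangle.mk (f j) (g j) (h j) ∈ distTriang D)
    (b₁ : BinaryBicone (X₁ .left) (X₁ .right)) (h₁ : b₁.IsBilimit)
    (b₂ : BinaryBicone (X₂ .left) (X₂ .right)) (h₂ : b₂.IsBilimit)
    (b₃ : BinaryBicone (X₃ .left) (X₃ .right)) (h₃ : b₃.IsBilimit) :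
    Triangle.mk (b₁.fst ≫ f .left ≫ b₂.inl + b₁.snd ≫ f .right ≫ b₂.inr)
      (b₂.fst ≫ g .left ≫ b₃.inl + b₂.snd ≫ g .right ≫ b₃.inr)
      ((b₃.fst ≫ h .left) ≫ b₁.inl⟦(1 : ℤ)⟧' + (b₃.snd ≫ h .right) ≫ b₁.inr⟦(1 : ℤ)⟧') ∈
        distTriang D := by
  refine dist_of_iso (pi_distinguished X₁ X₂ X₃ f g h H) (biconeIsoPi X₁ b₁ h₁)
    (biconeIsoPi X₂ b₂ h₂) (biconeIsoPi X₃ b₃ h₃) ?_ ?_ ?_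
  · apply Pi.hom_ext
    rintro (_ | _)
    · simp [biconeIsoPi_hom_π_left, reassoc_of% biconeIsoPi_hom_π_left X₁ b₁ h₁]
    · simp [biconeIsoPi_hom_π_right, reassoc_of% biconeIsoPi_hom_π_right X₁ b₁ h₁]
  · apply Pi.hom_ext
    rintro (_ | _)
    · simp [biconeIsoPi_hom_π_left, reassoc_of% biconeIsoPi_hom_π_left X₂ b₂ h₂]
    · simp [biconeIsoPi_hom_π_right, reassoc_of% biconeIsoPi_hom_π_right X₂ b₂ h₂]
  · rw [← cancel_mono (piComparison (shiftFunctor D (1 : ℤ)) X₁)]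
    simp only [assoc, IsIso.inv_hom_id, comp_id]
    apply Pi.hom_ext
    rintro (_ | _)
    · simp [← CategoryTheory.Functor.map_comp, biconeIsoPi_hom_π_left,
        reassoc_of% biconeIsoPi_hom_π_left X₃ b₃ h₃]
    · simp [← CategoryTheory.Functor.map_comp, biconeIsoPi_hom_π_right,
        reassoc_of% biconeIsoPi_hom_π_right X₃ b₃ h₃]

theorem sum_distinguished {A B X A' B' X' : D} {x : A ⟶ B} {y : B ⟶ X} {δ : X ⟶ A⟦(1 : ℤ)⟧}
    {x' : A' ⟶ B'} {y' : B' ⟶ X'} {δ' : X' ⟶ A'⟦(1 : ℤ)⟧}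
    (h : Triangle.mk x y δ ∈ distTriang D) (h' : Triangle.mk x' y' δ' ∈ distTriang D)
    (bA : BinaryBicone A A') (hA : bA.IsBilimit) (bB : BinaryBicone B B') (hB : bB.IsBilimit)
    (bX : BinaryBicone X X') (hX : bX.IsBilimit) :
    Triangle.mk (bA.fst ≫ x ≫ bB.inl + bA.snd ≫ x' ≫ bB.inr)
      (bB.fst ≫ y ≫ bX.inl + bB.snd ≫ y' ≫ bX.inr)
      ((bX.fst ≫ δ) ≫ bA.inl⟦(1 : ℤ)⟧' + (bX.snd ≫ δ') ≫ bA.inr⟦(1 : ℤ)⟧') ∈ distTriang D :=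
  family_sum_distinguished (WalkingPair.rec A A') (WalkingPair.rec B B') (WalkingPair.rec X X')
    (WalkingPair.rec x x') (WalkingPair.rec y y') (WalkingPair.rec δ δ') (WalkingPair.rec h h')
    bA hA bB hB bX hX

theorem zero_distinguished {A X : D} (b : BinaryBicone A X) (hb : b.IsBilimit) :
    Triangle.mk b.inl b.snd (0 : X ⟶ A⟦(1 : ℤ)⟧) ∈ distTriang D := by
  refine dist_of_iso (binaryBiproductTriangle_distinguished A X) (Iso.refl A)
    { hom := biprod.lift b.fst b.snd
      inv := biprod.desc b.inl b.inr
      hom_inv_id := by rw [biprod.lift_desc]; exact IsBilimit.binary_total hb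
      inv_hom_id := by ext <;> simp } (Iso.refl X) ?_ ?_ ?_
  · ext <;> simp
  · simp
  · simp

section ExtensionClosed

variable (P : ObjectProperty D)

/-- The image of a bicone under the inclusion of a full subcategory. -/
@[simps]
def mapBicone {X Y : P.FullSubcategory} (b : BinaryBicone X Y) : BinaryBicone X.obj Y.obj where
  pt := b.pt.obj
  fst := b.fst.hom
  snd := b.snd.hom
  inl := b.inl.hom
  inr := b.inr.hom
  inl_fst := congrArg InducedCategory.Hom.hom b.inl_fst
  inl_snd := congrArg InducedCategory.Hom.hom b.inl_snd
  inr_fst := congrArg InducedCategory.Hom.hom b.inr_fst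
  inr_snd := congrArg InducedCategory.Hom.hom b.inr_snd

/-- The image of a bilimit bicone under the inclusion of a full subcategory is bilimit. -/
def isBilimitMapBicone {X Y : P.FullSubcategory} {b : BinaryBicone X Y} (hb : b.IsBilimit) :
    (mapBicone P b).IsBilimit :=
  isBinaryBilimitOfTotal _ (congrArg (fun f : b.pt ⟶ b.pt => f.hom) (IsBilimit.binary_total hb))

/-- The bifunctor `𝔼(X, A) = Hom(X, ΣA)` on a full subcategory of a triangulated category. -/
def shiftHom : P.FullSubcategoryᵒᵖ ⥤ P.FullSubcategory ⥤ AddCommGrpCat.{v} where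
  obj X :=
    { obj A := AddCommGrpCat.of (X.unop.obj ⟶ A.obj⟦(1 : ℤ)⟧)
      map a := AddCommGrpCat.ofHom
        { toFun δ := δ ≫ a.hom⟦(1 : ℤ)⟧'
          map_zero' := by simp
          map_add' _ _ := by simp }
      map_id _ := by
        ext δ
        exact (congrArg (δ ≫ ·) (CategoryTheory.Functor.map_id _ _)).trans (comp_id δ)
      map_comp a a' := by
        ext δ
        exact (congrArg (δ ≫ ·) (CategoryTheory.Functor.map_comp _ _ _)).trans (assoc _ _ _).symm }
  map c :=
    { app A := AddCommGrpCat.ofHom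
        { toFun δ := c.unop.hom ≫ δ
          map_zero' := by simp
          map_add' _ _ := by simp }
      naturality _ _ a := by
        ext δ
        exact (assoc _ _ _).symm }
  map_id _ := by
    ext A δ
    exact id_comp _
  map_comp c c' := by
    ext A δ
    exact assoc _ _ _

instance [P.ContainsZero] : HasZeroObject P.FullSubcategory :=
  have ⟨Z, hZ, hPZ⟩ := P.exists_prop_of_containsZero
  ⟨⟨Z, hPZ⟩, by
    rw [IsZero.iff_id_eq_zero]
    ext
    exact hZ.eq_of_src _ _⟩

variable [P.IsClosedUnderIsomorphisms] [P.IsTriangulatedClosed₂]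

theorem prop_biprod {X Y : D} (hX : P X) (hY : P Y) : P (X ⊞ Y) :=
  P.ext_of_isTriangulatedClosed₂ _ (binaryBiproductTriangle_distinguished X Y) hX hY

instance : HasBinaryBiproducts P.FullSubcategory :=
  ⟨fun X Y => hasBinaryBiproduct_of_total
    { pt := ⟨X.obj ⊞ Y.obj, prop_biprod P X.property Y.property⟩
      fst := ObjectProperty.homMk biprod.fst
      snd := ObjectProperty.homMk biprod.snd
      inl := ObjectProperty.homMk biprod.inl
      inr := ObjectProperty.homMk biprod.inr
      inl_fst := by ext; simp
      inl_snd := by ext; simp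
      inr_fst := by ext; simp
      inr_snd := by ext; simp } (by
    apply ObjectProperty.hom_ext
    exact biprod.total (X := X.obj) (Y := Y.obj))⟩

variable [P.ContainsZero] [IsTriangulated D]

/-- An extension-closed subcategory of a triangulated category is extriangulated:
`𝔼(X, A) = Hom(X, ΣA)`, and `δ : X ⟶ ΣA` is realized by the sequences `A ⟶ B ⟶ X` such that
`A ⟶ B ⟶ X ⟶ ΣA` is a distinguished triangle. -/
noncomputable def extensionClosedStructure : ExtriangulatedStructure.{v} P.FullSubcategory where
  E := shiftHom P
  additive_right X := ⟨fun {A A' f g} => by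
    ext δ
    exact (congrArg (δ ≫ ·) (CategoryTheory.Functor.map_add _)).trans
      (Preadditive.comp_add _ _ _ _ _ _)⟩
  additive_left A := ⟨fun {X X' f g} => by
    ext δ
    exact Preadditive.add_comp _ _ _ _ _ _⟩
  Realizes {A B X} δ x y := Triangle.mk x.hom y.hom δ ∈ distTriang D
  exists_realizes {A X} δ := by
    obtain ⟨B, hB, x, y, h⟩ := P.distinguished_cocone_triangle₂ (X := A.obj) (Z := X.obj) δ
      A.property X.property
    exact ⟨⟨B, hB⟩, ObjectProperty.homMk x, ObjectProperty.homMk y, h⟩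
  realizes_iff {A B B' X} δ x y x' y' h := by
    refine (dist_iff_of_dist x'.hom y'.hom h).trans ⟨?_, ?_⟩
    · rintro ⟨b, h₁, h₂⟩
      exact ⟨P.isoMk b, by ext; exact h₁, by ext; exact h₂⟩
    · rintro ⟨b, h₁, h₂⟩
      exact ⟨P.ι.mapIso b, congrArg (fun f => f.hom) h₁, congrArg (fun f => f.hom) h₂⟩
  realizes_hom {A B X A' B' X' δ x y δ' x' y'} h h' a c hac := by
    obtain ⟨b, h₁, h₂⟩ := complete_distinguished_triangle_morphism₂ _ _ h h' a.hom c.hom hac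
    exact ⟨ObjectProperty.homMk b, by ext; exact h₁, by ext; exact h₂⟩
  realizes_zero b hb := zero_distinguished (mapBicone P b) (isBilimitMapBicone P hb)
  realizes_sum h h' bA hA bB hB bX hX :=
    sum_distinguished h h' (mapBicone P bA) (isBilimitMapBicone P hA)
      (mapBicone P bB) (isBilimitMapBicone P hB) (mapBicone P bX) (isBilimitMapBicone P hX)
  et3 {A B X A' B' X' δ x y δ' x' y'} h h' a b hab := by
    obtain ⟨c, h₁, h₂⟩ := complete_distinguished_triangle_morphism _ _ h h' a.hom b.hom
      (congrArg InducedCategory.Hom.hom hab)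
    exact ⟨ObjectProperty.homMk c, by ext; exact h₁, h₂⟩
  et3op {A B X A' B' X' δ x y δ' x' y'} h h' b c hbc := by
    obtain ⟨a, h₁, h₂⟩ := complete_distinguished_triangle_morphism₁ _ _ h h' b.hom c.hom
      (congrArg InducedCategory.Hom.hom hbc)
    exact ⟨ObjectProperty.homMk a, by ext; exact h₁, h₂⟩
  et4 {A B C D F δ f f' δ' g g'} h h' := by
    obtain ⟨Z, k, δ'', hZ⟩ := distinguished_cocone_triangle (f.hom ≫ g.hom)
    let o := someOctahedron rfl h h' hZ
    have hPZ : P Z := P.ext_of_isTriangulatedClosed₂ _ o.mem D.property F.property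
    exact ⟨⟨Z, hPZ⟩, ObjectProperty.homMk k, ObjectProperty.homMk o.m₁, ObjectProperty.homMk o.m₃,
      δ'', hZ, by ext; exact o.comm₁, by ext; exact o.comm₃, o.mem, o.comm₂, o.comm₄⟩
  et4op {A B C D F δ f' f δ' g' g} h h' := by
    obtain ⟨Z, k, δ'', hZ⟩ := distinguished_cocone_triangle₁ (f.hom ≫ g.hom)
    let o := someOctahedron' rfl h h' hZ
    have hPZ : P Z := P.ext_of_isTriangulatedClosed₂ _ o.mem D.property F.property
    exact ⟨⟨Z, hPZ⟩, ObjectProperty.homMk k, ObjectProperty.homMk o.m₁, ObjectProperty.homMk o.m₃,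
      δ'', hZ, by ext; exact o.comm₁, by ext; exact o.comm₄.symm, o.mem, o.comm₃.symm, o.comm₂⟩

end ExtensionClosed

/-! ### Smashing conditions on t-structures -/

/-- `Free(P)`: the objects which are coproducts of families of objects of `P`. -/
def freeClosure (P : ObjectProperty D) : ObjectProperty D := fun C =>
  ∃ (I : Type w) (X : I → D) (ι : ∀ i, X i ⟶ C),
    (∀ i, P (X i)) ∧ Nonempty (IsColimit (Cofan.mk C ι))

/-- `coFree(P)`: the objects which are products of families of objects of `P`. -/
def cofreeClosure (P : ObjectProperty D) : ObjectProperty D := fun C =>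
  ∃ (I : Type w) (X : I → D) (π : ∀ i, C ⟶ X i),
    (∀ i, P (X i)) ∧ Nonempty (IsLimit (Fan.mk C π))

/-- A t-structure `(U, W) = (D^{≤ 0}, D^{≥ 0})` is `n`-smashing if
`Free(W) ⊆ Σⁿ W = D^{≥ -n}`. It is smashing if it is `0`-smashing. -/
def NSmashing (x : TStructure D) (n : ℕ) : Prop :=
  freeClosure.{w} (x.ge 0) ≤ x.ge (-(n : ℤ))

/-- A t-structure `(U, W) = (D^{≤ 0}, D^{≥ 0})` is `n`-co-smashing if
`coFree(U) ⊆ Σ⁻ⁿ U = D^{≤ n}`. It is co-smashing if it is `0`-co-smashing. -/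
def NCoSmashing (x : TStructure D) (n : ℕ) : Prop :=
  cofreeClosure.{w} (x.le 0) ≤ x.le (n : ℤ)

/-- The `n`-extended heart `W ∩ Σ^{-n+1} U = D^{≥ 0} ∩ D^{≤ n-1}` of a t-structure. -/
def extendedHeart (x : TStructure D) (n : ℕ) : ObjectProperty D :=
  x.ge 0 ⊓ x.le ((n : ℤ) - 1)

instance (x : TStructure D) (n : ℕ) : (extendedHeart x n).ContainsZero where
  exists_zero := ⟨_, isZero_zero D,
    (x.isGE_of_isZero (isZero_zero D) 0).ge, (x.isLE_of_isZero (isZero_zero D) _).le⟩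

instance (x : TStructure D) (n : ℕ) : (extendedHeart x n).IsClosedUnderIsomorphisms :=
  inferInstanceAs (x.ge 0 ⊓ x.le ((n : ℤ) - 1)).IsClosedUnderIsomorphisms

instance (x : TStructure D) (n : ℕ) : (extendedHeart x n).IsTriangulatedClosed₂ :=
  .mk' fun T hT h₁ h₃ =>
    ⟨(x.isGE₂ T hT 0 ⟨h₁.1⟩ ⟨h₃.1⟩).ge, (x.isLE₂ T hT _ ⟨h₁.2⟩ ⟨h₃.2⟩).le⟩

/-- The extriangulated structure of the `n`-extended heart. -/
noncomputable def extendedHeartStructure [IsTriangulated D] (x : TStructure D) (n : ℕ) :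
    ExtriangulatedStructure.{v} (extendedHeart x n).FullSubcategory :=
  extensionClosedStructure (extendedHeart x n)

end Triangulated

end Extri

namespace Extri

/-! ### Coproducts and products -/

section Cofans

variable {𝒞 : Type u} [Category.{v} 𝒞] {I : Type w} {X : I → 𝒞} {P : 𝒞}

/-! Smashing implies AET4: `x.le k` is always closed under coproducts, since it is a left orthogonal
class; smashing adds `x.ge 0`, so coproducts in `𝒞ₙ` are those of `D`. As coproducts of triangles
are triangles (`coproduct_distinguished`), the universal property yields exactly one candidate for
`Γ(η)`, and uniqueness forces every required identity.

AET3.5 implies smashing: if `A` lies in degrees `[1, n-1]`, then `A` and `ΣA` are both in `𝒞ₙ` and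
`A ⟶ 0 ⟶ ΣA` is a realized sequence. Its coproduct in `𝒞ₙ` again has zero middle term and third term
in degrees `≥ 0`, so the coproduct of copies of `A` in `𝒞ₙ` lies in degrees `≥ 1`. Hence a coproduct
of copies of `A` in `D` known to be in `≥ 0` is in fact in `≥ 1` (`ge_one_of_aet35`). For `M` in the
heart, `(n-1)`-smashing places `M^(I)` in degrees `≥ -(n-1)`, and shifted copies of this gain raise
the bound by one until it is `0`. Dévissage along truncations passes from the heart to `𝒞ₙ`.

For an arbitrary family in `x.ge 0`, the truncations in degrees `≥ n` can afford the loss of `n-1`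
degrees. The remaining parts lie in `𝒞ₙ` and are retracts of a single object of `𝒞ₙ`, which reduces
to constant families. The second half is dual, with products. -/

theorem exists_desc {ι : ∀ i, X i ⟶ P} (h : IsColimit (Cofan.mk P ι)) {A : 𝒞}
    (f : ∀ i, X i ⟶ A) : ∃ g : P ⟶ A, ∀ i, ι i ≫ g = f i :=
  ⟨Cofan.IsColimit.desc h f, Cofan.IsColimit.fac h f⟩

theorem exists_lift {π : ∀ i, P ⟶ X i} (h : IsLimit (Fan.mk P π)) {A : 𝒞}
    (f : ∀ i, A ⟶ X i) : ∃ g : A ⟶ P, ∀ i, g ≫ π i = f i :=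
  ⟨Fan.IsLimit.lift h f, Fan.IsLimit.fac h f⟩

theorem cofan_hom_ext {ι : ∀ i, X i ⟶ P} (h : IsColimit (Cofan.mk P ι)) {A : 𝒞}
    {f g : P ⟶ A} (hfg : ∀ i, ι i ≫ f = ι i ≫ g) : f = g :=
  Cofan.IsColimit.hom_ext h f g hfg

theorem fan_hom_ext {π : ∀ i, P ⟶ X i} (h : IsLimit (Fan.mk P π)) {A : 𝒞}
    {f g : A ⟶ P} (hfg : ∀ i, f ≫ π i = g ≫ π i) : f = g :=
  Fan.IsLimit.hom_ext h f g hfg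

/-- A colimit cofan in the opposite category is a limit fan. -/
def isLimitUnopCofan {X : I → 𝒞ᵒᵖ} {P : 𝒞ᵒᵖ} {ι : ∀ i, X i ⟶ P}
    (h : IsColimit (Cofan.mk P ι)) :
    IsLimit (Fan.mk (f := fun i => (X i).unop) P.unop fun i => (ι i).unop) :=
  Fan.IsLimit.mk _ (fun s => (Cofan.IsColimit.desc h fun i => (s.proj i).op).unop)
    (fun s i => Quiver.Hom.op_inj (Cofan.IsColimit.fac h (fun i => (s.proj i).op) i))
    (fun s _ hm => Quiver.Hom.op_inj (cofan_hom_ext h fun i =>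
      (congrArg Quiver.Hom.op (hm i)).trans
        (Cofan.IsColimit.fac h (fun i => (s.proj i).op) i).symm))

variable (Q : ObjectProperty 𝒞)

/-- A cofan in a full subcategory is colimit if it is so in the ambient category. -/
noncomputable def isColimitFullCofan {X : I → Q.FullSubcategory} {P : Q.FullSubcategory}
    {ι : ∀ i, X i ⟶ P}
    (h : IsColimit (Cofan.mk (f := fun i => (X i).obj) P.obj fun i => (ι i).hom)) :
    IsColimit (Cofan.mk P ι) :=
  isColimitOfIsColimitCofanMkObj Q.ι X ι h

/-- A fan in a full subcategory is limit if it is so in the ambient category. -/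
noncomputable def isLimitFullFan {X : I → Q.FullSubcategory} {P : Q.FullSubcategory}
    {π : ∀ i, P ⟶ X i}
    (h : IsLimit (Fan.mk (f := fun i => (X i).obj) P.obj fun i => (π i).hom)) :
    IsLimit (Fan.mk P π) :=
  isLimitOfIsLimitFanMkObj Q.ι X π h

end Cofans

/-! ### A criterion for AET4, and consequences of AET3.5 -/

namespace ExtriangulatedStructure

variable {𝒞 : Type u} [Category.{v} 𝒞] [Preadditive 𝒞] [HasZeroObject 𝒞] [HasBinaryBiproducts 𝒞]
  (S : ExtriangulatedStructure.{e} 𝒞)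

theorem push_comp {X A A' A'' : 𝒞} (a : A ⟶ A') (b : A' ⟶ A'') (δ : ExtGroup S.E X A) :
    push (a ≫ b) δ = push b (push a δ) := by
  simp [push]

theorem pull_comp {X X' X'' A : 𝒞} (c : X' ⟶ X) (d : X'' ⟶ X') (δ : ExtGroup S.E X A) :
    pull (d ≫ c) δ = pull d (pull c δ) := by
  simp [pull]

/-- If extensions of a coproduct are determined by their restrictions to the summands, and if
every family of extensions has a sum which is realized by the coproducts of the sequences
realizing the family, then the category is AET4. -/
theorem aet4_of_unique_of_exists
    (hcolim : ∀ (I : Type w), HasColimitsOfShape (Discrete I) 𝒞)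
    (huniq : ∀ (I : Type w) (B : I → 𝒞) (A : 𝒞) (γ γ' : ExtGroup S.E (∐ B) A),
      (∀ i, pull (Limits.Sigma.ι B i) γ = pull (Limits.Sigma.ι B i) γ') → γ = γ')
    (hex : ∀ (I : Type w) (B : I → 𝒞) (A : 𝒞) (η : ∀ i, ExtGroup S.E (B i) A),
      ∃ γ : ExtGroup S.E (∐ B) (∐ fun _ : I => A),
        (∀ i, pull (Limits.Sigma.ι B i) γ = push (Limits.Sigma.ι (fun _ : I => A) i) (η i)) ∧
        ∀ (F : I → 𝒞) (x : ∀ i, A ⟶ F i) (y : ∀ i, F i ⟶ B i),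
          (∀ i, S.Realizes (η i) (x i) (y i)) →
            S.Realizes γ (Limits.Sigma.map x) (Limits.Sigma.map y)) :
    AET4.{w} S := by
  intro I _
  refine ⟨hcolim I, ?_⟩
  choose γ hγ hγr using hex I
  refine ⟨⟨fun B A => AddMonoidHom.mk' (γ B A) ?_, ?_, ?_, ?_⟩, hγ⟩
  -- Additivity and both naturalities are identities between extensions of a coproduct, so they are
  -- tested on each summand, where `hγ` computes both sides.
  · intro η η'
    refine huniq I _ _ _ _ fun i => ?_
    rw [hγ]
    simp only [pull, push, map_add, Pi.add_apply]
    exact (congrArg₂ (· + ·) (hγ B A η i) (hγ B A η' i)).symm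
  · intro B B' A f η
    refine huniq I _ _ _ _ fun i => ?_
    change pull _ (γ _ _ _) = pull _ (pull _ (γ _ _ _))
    rw [hγ, ← pull_comp, Sigma.ι_map, pull_comp, hγ, push_pull]
  · intro B A A' g η
    refine huniq I _ _ _ _ fun i => ?_
    change pull _ (γ _ _ _) = pull _ (push _ (γ _ _ _))
    rw [hγ, ← push_pull, hγ, ← push_comp, ← push_comp, Sigma.ι_map]
  · intro B F A η x y h
    exact hγr B A η F x y h

theorem AET4.aet35 {S : ExtriangulatedStructure.{e} 𝒞} (h : AET4.{w} S) : AET35.{w} S :=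
  fun I _ => (h I).imp fun _ ⟨G, _⟩ => ⟨G⟩

/-- In an AET3.5 category, sequences with vanishing middle term induce such sequences on
coproducts. -/
theorem AET35.exists_realizes_of_isZero {S : ExtriangulatedStructure.{e} 𝒞} (h : AET35.{w} S)
    {A F B : 𝒞} {δ : ExtGroup S.E B A} {x : A ⟶ F} {y : F ⟶ B} (hδ : S.Realizes δ x y)
    (hF : IsZero F) (I : Type w) [Nonempty I] :
    ∃ (A' F' B' : 𝒞) (a : I → (A ⟶ A')) (b : I → (B ⟶ B')) (γ : ExtGroup S.E B' A')
      (x' : A' ⟶ F') (y' : F' ⟶ B'), Nonempty (IsColimit (Cofan.mk A' a)) ∧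
        Nonempty (IsColimit (Cofan.mk B' b)) ∧ IsZero F' ∧ S.Realizes γ x' y' := by
  obtain ⟨_, ⟨G⟩⟩ := h I
  refine ⟨_, _, _, Limits.Sigma.ι _, Limits.Sigma.ι _, _, _, _, ⟨coproductIsCoproduct _⟩,
    ⟨coproductIsCoproduct _⟩, ?_, G.realizes (fun _ => δ) (fun _ => x) (fun _ => y) fun _ => hδ⟩
  rw [IsZero.iff_id_eq_zero]
  exact Sigma.hom_ext _ _ fun i => hF.eq_of_src _ _

/-- In an AET3.5 category, every object of a family is a retract of a fixed object. -/
theorem AET35.exists_retract {S : ExtriangulatedStructure.{e} 𝒞} (h : AET35.{w} S)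
    {I : Type w} [Nonempty I] (X : I → 𝒞) :
    ∃ (A : 𝒞) (s : ∀ i, X i ⟶ A) (r : ∀ i, A ⟶ X i), ∀ i, s i ≫ r i = 𝟙 (X i) := by
  obtain ⟨_, _⟩ := h I
  classical
  exact ⟨∐ X, Limits.Sigma.ι X, fun i => Limits.Sigma.π X i, fun i => by simp⟩

end ExtriangulatedStructure

/-! ### Coproducts and products of distinguished triangles -/

section Triangles

variable {D : Type u} [Category.{v} D] [Preadditive D] [HasZeroObject D] [HasShift D ℤ]
  [∀ n : ℤ, (shiftFunctor D n).Additive] [Pretriangulated D] {I : Type w}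

/-- The shift of a colimit cofan. -/
noncomputable def isColimitShift {X : I → D} {P : D} {ι : ∀ i, X i ⟶ P}
    (h : IsColimit (Cofan.mk P ι)) (k : ℤ) :
    IsColimit (Cofan.mk (P⟦k⟧) fun i => (ι i)⟦k⟧') :=
  isColimitCofanMkObjOfIsColimit (shiftFunctor D k) _ ι h

/-- The shift of a limit fan. -/
noncomputable def isLimitShift {X : I → D} {P : D} {π : ∀ i, P ⟶ X i}
    (h : IsLimit (Fan.mk P π)) (k : ℤ) :
    IsLimit (Fan.mk (P⟦k⟧) fun i => (π i)⟦k⟧') :=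
  isLimitFanMkObjOfIsLimit (shiftFunctor D k) _ π h

/-! ### Exact `Hom` sequences of one triangle -/

section Exactness

variable {A F B Z : D} {x : A ⟶ F} {y : F ⟶ B} {δ : B ⟶ A⟦(1 : ℤ)⟧}

theorem dist_comp₁₂ (h : Triangle.mk x y δ ∈ distTriang D) : x ≫ y = 0 :=
  comp_distTriang_mor_zero₁₂ _ h

theorem dist_comp₃₁ (h : Triangle.mk x y δ ∈ distTriang D) : δ ≫ x⟦(1 : ℤ)⟧' = 0 :=
  comp_distTriang_mor_zero₃₁ _ h

theorem dist_yoneda₂ (h : Triangle.mk x y δ ∈ distTriang D)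
    (g : F ⟶ Z) (hg : x ≫ g = 0) : ∃ k : B ⟶ Z, g = y ≫ k :=
  Triangle.yoneda_exact₂ _ h g hg

theorem dist_yoneda₃ (h : Triangle.mk x y δ ∈ distTriang D)
    (g : B ⟶ Z) (hg : y ≫ g = 0) : ∃ k : A⟦(1 : ℤ)⟧ ⟶ Z, g = δ ≫ k :=
  Triangle.yoneda_exact₃ _ h g hg

theorem dist_yoneda₁ (h : Triangle.mk x y δ ∈ distTriang D)
    (g : A⟦(1 : ℤ)⟧ ⟶ Z) (hg : δ ≫ g = 0) :
    ∃ k : F⟦(1 : ℤ)⟧ ⟶ Z, g = x⟦(1 : ℤ)⟧' ≫ k := by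
  -- Rotation puts a sign on the shifted first morphism; it is absorbed by replacing `k` with `-k`.
  obtain ⟨k, hk⟩ : ∃ k : F⟦(1 : ℤ)⟧ ⟶ Z, g = (-x⟦(1 : ℤ)⟧') ≫ k :=
    Triangle.yoneda_exact₃ _ (rot_of_distTriang _ h) g hg
  exact ⟨-k, by simpa using hk⟩

theorem dist_coyoneda₁ (h : Triangle.mk x y δ ∈ distTriang D)
    (g : Z ⟶ A⟦(1 : ℤ)⟧) (hg : g ≫ x⟦(1 : ℤ)⟧' = 0) :
    ∃ k : Z ⟶ B, g = k ≫ δ :=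
  Triangle.coyoneda_exact₁ _ h g hg

theorem dist_coyoneda₂ (h : Triangle.mk x y δ ∈ distTriang D)
    (g : Z ⟶ F) (hg : g ≫ y = 0) : ∃ k : Z ⟶ A, g = k ≫ x :=
  Triangle.coyoneda_exact₂ _ h g hg

theorem dist_coyoneda₃ (h : Triangle.mk x y δ ∈ distTriang D)
    (g : Z ⟶ B) (hg : g ≫ δ = 0) : ∃ k : Z ⟶ F, g = k ≫ y :=
  Triangle.coyoneda_exact₃ _ h g hg

theorem dist_complete (h : Triangle.mk x y δ ∈ distTriang D)
    {A' F' B' : D} {x' : A' ⟶ F'} {y' : F' ⟶ B'} {δ' : B' ⟶ A'⟦(1 : ℤ)⟧}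
    (h' : Triangle.mk x' y' δ' ∈ distTriang D) (a : A ⟶ A') (f : F ⟶ F')
    (haf : x ≫ f = a ≫ x') :
    ∃ b : B ⟶ B', y ≫ b = f ≫ y' ∧ δ ≫ a⟦(1 : ℤ)⟧' = b ≫ δ' :=
  complete_distinguished_triangle_morphism _ _ h h' a f haf

end Exactness

theorem dist_of_comparison {A F B C : D} {x : A ⟶ F} {y : F ⟶ B} {δ : B ⟶ A⟦(1 : ℤ)⟧}
    {y' : F ⟶ C} {δ' : C ⟶ A⟦(1 : ℤ)⟧} (h : Triangle.mk x y' δ' ∈ distTriang D)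
    (φ : B ≅ C) (h₁ : y ≫ φ.hom = y') (h₂ : φ.hom ≫ δ' = δ) :
    Triangle.mk x y δ ∈ distTriang D :=
  dist_of_iso h (Iso.refl A) (Iso.refl F) φ (by simp) (by simp [h₁]) (by simp [h₂])

/-- The summand triangles map to a cone `C` of `x'`, and these maps assemble to `φ : B' ⟶ C`. The
five lemma for triangles is unavailable, since the candidate is not yet known to be distinguished;
instead `Hom(φ, Z)` is shown bijective by chasing the product of the exact sequences of the
summands. Only the three given cofans and their shifts need be colimits. -/
theorem coproduct_distinguished {A F B : I → D} {x : ∀ i, A i ⟶ F i} {y : ∀ i, F i ⟶ B i}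
    {δ : ∀ i, B i ⟶ (A i)⟦(1 : ℤ)⟧} (H : ∀ i, Triangle.mk (x i) (y i) (δ i) ∈ distTriang D)
    {A' F' B' : D} {a : ∀ i, A i ⟶ A'} {f : ∀ i, F i ⟶ F'} {b : ∀ i, B i ⟶ B'}
    (hA : IsColimit (Cofan.mk A' a)) (hF : IsColimit (Cofan.mk F' f))
    (hB : IsColimit (Cofan.mk B' b)) {x' : A' ⟶ F'} {y' : F' ⟶ B'} {δ' : B' ⟶ A'⟦(1 : ℤ)⟧}
    (hx : ∀ i, a i ≫ x' = x i ≫ f i) (hy : ∀ i, f i ≫ y' = y i ≫ b i)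
    (hδ : ∀ i, b i ≫ δ' = δ i ≫ (a i)⟦(1 : ℤ)⟧') : Triangle.mk x' y' δ' ∈ distTriang D := by
  obtain ⟨C, y'', δ'', hC⟩ := distinguished_cocone_triangle x'
  have hφ (i) := dist_complete (H i) hC (a i) (f i) (hx i).symm
  choose φi h₁ h₂ using hφ
  obtain ⟨φ, hφ⟩ := exists_desc hB φi
  have e₁ : y' ≫ φ = y'' := cofan_hom_ext hF fun i => by
    rw [← assoc, hy, assoc, hφ, h₁]
  have e₂ : φ ≫ δ'' = δ' := cofan_hom_ext hB fun i => by
    rw [← assoc, hφ, hδ, h₂]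
  have hxy : x' ≫ y' = 0 := cofan_hom_ext hA fun i => by
    have := dist_comp₁₂ (H i)
    rw [← assoc, hx, assoc, hy, ← assoc, this, zero_comp, comp_zero]
  have : IsIso φ := by
    -- Factorizations are chosen on each summand, then glued through the colimit cofans of the
    -- shifts.
    refine isIso_of_coyoneda_map_bijective _ fun Z => ⟨?_, fun g => ?_⟩
    · suffices ∀ g : C ⟶ Z, φ ≫ g = 0 → g = 0 by
        intro g₁ g₂ hg
        rw [← sub_eq_zero]
        apply this
        simpa [sub_eq_zero] using hg
      intro g hg
      obtain ⟨h, rfl⟩ := dist_yoneda₃ hC g (by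
        rw [← e₁, assoc, hg, comp_zero])
      have hk (i) : ∃ k : (F i)⟦(1 : ℤ)⟧ ⟶ Z, (a i)⟦(1 : ℤ)⟧' ≫ h = (x i)⟦(1 : ℤ)⟧' ≫ k := by
        exact dist_yoneda₁ (H i) _ (by
          rw [← assoc, ← hδ, ← e₂, assoc, assoc, hg, comp_zero])
      choose k hk using hk
      obtain ⟨l, hl⟩ := exists_desc (isColimitShift hF 1) k
      have : h = x'⟦(1 : ℤ)⟧' ≫ l := cofan_hom_ext (isColimitShift hA 1) fun i => by
        rw [hk, ← hl, ← assoc, ← assoc, ← Functor.map_comp, ← Functor.map_comp, hx]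
      have h0 := dist_comp₃₁ hC
      rw [this, reassoc_of% h0, zero_comp]
    · obtain ⟨k, hk⟩ := dist_yoneda₂ hC (y' ≫ g) (by
        rw [← assoc, hxy, zero_comp])
      have hl (i) : ∃ l : (A i)⟦(1 : ℤ)⟧ ⟶ Z, b i ≫ (g - φ ≫ k) = δ i ≫ l :=
        dist_yoneda₃ (H i) (b i ≫ (g - φ ≫ k)) (by
          rw [← assoc, ← hy, assoc, Preadditive.comp_sub, ← assoc y', e₁, hk, sub_self, comp_zero])
      choose l hl using hl
      obtain ⟨m, hm⟩ := exists_desc (isColimitShift hA 1) l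
      have : g - φ ≫ k = φ ≫ δ'' ≫ m := cofan_hom_ext hB fun i => by
        rw [hl, reassoc_of% e₂, ← assoc, hδ, assoc, hm]
      exact ⟨k + δ'' ≫ m, by simp [← this]⟩
  exact dist_of_comparison hC (asIso φ) e₁ e₂

/-- Dual chase: `φ` now goes from the cone to `B'` and is tested on `Hom(Z, -)`. Maps into `A'⟦1⟧`
are compared componentwise because the shift preserves products. -/
theorem product_distinguished {A F B : I → D} {x : ∀ i, A i ⟶ F i} {y : ∀ i, F i ⟶ B i}
    {δ : ∀ i, B i ⟶ (A i)⟦(1 : ℤ)⟧} (H : ∀ i, Triangle.mk (x i) (y i) (δ i) ∈ distTriang D)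
    {A' F' B' : D} {a : ∀ i, A' ⟶ A i} {f : ∀ i, F' ⟶ F i} {b : ∀ i, B' ⟶ B i}
    (hA : IsLimit (Fan.mk A' a)) (hF : IsLimit (Fan.mk F' f))
    (hB : IsLimit (Fan.mk B' b)) {x' : A' ⟶ F'} {y' : F' ⟶ B'} {δ' : B' ⟶ A'⟦(1 : ℤ)⟧}
    (hx : ∀ i, x' ≫ f i = a i ≫ x i) (hy : ∀ i, y' ≫ b i = f i ≫ y i)
    (hδ : ∀ i, δ' ≫ (a i)⟦(1 : ℤ)⟧' = b i ≫ δ i) : Triangle.mk x' y' δ' ∈ distTriang D := by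
  obtain ⟨C, y'', δ'', hC⟩ := distinguished_cocone_triangle x'
  have hφ (i) := dist_complete hC (H i) (a i) (f i) (hx i)
  choose φi h₁ h₂ using hφ
  obtain ⟨φ, hφ⟩ := exists_lift hB φi
  have e₁ : y'' ≫ φ = y' := fan_hom_ext hB fun i => by
    rw [assoc, hφ, h₁, hy]
  have e₂ : φ ≫ δ' = δ'' := fan_hom_ext (isLimitShift hA 1) fun i => by
    rw [assoc, hδ, ← assoc, hφ, h₂]
  have hδx : δ' ≫ x'⟦(1 : ℤ)⟧' = 0 := fan_hom_ext (isLimitShift hF 1) fun i => by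
    have := dist_comp₃₁ (H i)
    rw [assoc, ← Functor.map_comp, hx, Functor.map_comp, ← assoc, hδ, assoc, this, comp_zero,
      zero_comp]
  have : IsIso φ := by
    refine isIso_of_yoneda_map_bijective _ fun Z => ⟨?_, fun g => ?_⟩
    · suffices ∀ g : Z ⟶ C, g ≫ φ = 0 → g = 0 by
        intro g₁ g₂ hg
        rw [← sub_eq_zero]
        apply this
        simpa [sub_eq_zero] using hg
      intro g hg
      obtain ⟨h, rfl⟩ := dist_coyoneda₃ hC g (by
        rw [← e₂, ← assoc, hg, zero_comp])
      have hk (i) : ∃ k : Z ⟶ A i, h ≫ f i = k ≫ x i :=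
        dist_coyoneda₂ (H i) (h ≫ f i) (by
          rw [assoc, ← hy, ← e₁, assoc, reassoc_of% hg, zero_comp])
      choose k hk using hk
      obtain ⟨l, hl⟩ := exists_lift hA k
      have : h = l ≫ x' := fan_hom_ext hF fun i => by
        rw [hk, ← hl, assoc, assoc, hx]
      have h0 := dist_comp₁₂ hC
      rw [this, assoc, h0, comp_zero]
    · obtain ⟨k, hk⟩ := dist_coyoneda₁ hC (g ≫ δ') (by
        rw [assoc, hδx, comp_zero])
      have hl (i) : ∃ l : Z ⟶ F i, (g - k ≫ φ) ≫ b i = l ≫ y i :=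
        dist_coyoneda₃ (H i) ((g - k ≫ φ) ≫ b i) (by
          rw [assoc, ← hδ, ← assoc, Preadditive.sub_comp, assoc k, e₂, hk, sub_self, zero_comp])
      choose l hl using hl
      obtain ⟨m, hm⟩ := exists_lift hF l
      have : g - k ≫ φ = m ≫ y'' ≫ φ := fan_hom_ext hB fun i => by
        rw [hl, e₁, assoc, hy, ← assoc, hm]
      exact ⟨k + m ≫ y'', by simp [← this]⟩
  exact dist_of_comparison hC (asIso φ).symm (by simp [← e₁]) (by simp [← e₂])

open scoped ZeroObject in
theorem dist_shift_neg_one (B : D) :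
    ∃ δ : B ⟶ B⟦(-1 : ℤ)⟧⟦(1 : ℤ)⟧,
      Triangle.mk (0 : B⟦(-1 : ℤ)⟧ ⟶ 0) (0 : 0 ⟶ B) δ ∈ distTriang D :=
  ⟨((shiftEquiv D (1 : ℤ)).counitIso.app B).inv,
    dist_of_iso (contractible_distinguished₂ (B⟦(-1 : ℤ)⟧)) (Iso.refl _) (Iso.refl _)
      ((shiftEquiv D (1 : ℤ)).counitIso.app B).symm (zero_comp.trans comp_zero.symm)
      (zero_comp.trans comp_zero.symm) (by simp)⟩

theorem exists_dist_sigma {I : Type w} [HasColimitsOfShape (Discrete I) D] {A F B : I → D}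
    {f : ∀ i, A i ⟶ F i} {g : ∀ i, F i ⟶ B i} {δ : ∀ i, B i ⟶ (A i)⟦(1 : ℤ)⟧}
    (H : ∀ i, Triangle.mk (f i) (g i) (δ i) ∈ distTriang D) :
    ∃ γ, Triangle.mk (Limits.Sigma.map f) (Limits.Sigma.map g) γ ∈ distTriang D := by
  obtain ⟨γ, hγ⟩ := exists_desc (coproductIsCoproduct B)
    fun i => δ i ≫ (Limits.Sigma.ι A i)⟦(1 : ℤ)⟧'
  exact ⟨γ, coproduct_distinguished H (coproductIsCoproduct _) (coproductIsCoproduct _)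
    (coproductIsCoproduct _) (Sigma.ι_map f) (Sigma.ι_map g) hγ⟩

theorem exists_dist_pi {I : Type w} [HasLimitsOfShape (Discrete I) D] {A F B : I → D}
    {f : ∀ i, A i ⟶ F i} {g : ∀ i, F i ⟶ B i} {δ : ∀ i, B i ⟶ (A i)⟦(1 : ℤ)⟧}
    (H : ∀ i, Triangle.mk (f i) (g i) (δ i) ∈ distTriang D) :
    ∃ γ, Triangle.mk (Limits.Pi.map f) (Limits.Pi.map g) γ ∈ distTriang D := by
  obtain ⟨γ, hγ⟩ := exists_lift (isLimitShift (productIsProduct A) 1)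
    fun i => Pi.π B i ≫ δ i
  exact ⟨γ, product_distinguished H (productIsProduct _) (productIsProduct _)
    (productIsProduct _) (Pi.map_π f) (Pi.map_π g) hγ⟩

end Triangles

end Extri

namespace Extri

section

variable {D : Type u} [Category.{v} D] [Preadditive D] [HasZeroObject D] [HasShift D ℤ]
  [∀ n : ℤ, (shiftFunctor D n).Additive] [Pretriangulated D]

/-! ### Extension-closed subcategories with exact coproducts or products -/

section ExactSums

variable [IsTriangulated D] (P : ObjectProperty D) [P.IsClosedUnderIsomorphisms]
  [P.IsTriangulatedClosed₂] [P.ContainsZero]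

/-- Closure of `P` makes the inclusion into `D` preserve coproducts, so `Hom(∐ B, ΣA)` is the
product of the groups `Hom(Bᵢ, ΣA)`, and `Γ(η)` is the morphism with components `ηᵢ` followed by the
shifted inclusions. -/
theorem extensionClosedStructure_aet4 (hD : HasCoproducts.{w} D)
    (hP : ∀ (I : Type w) (X : I → D) (C : D) (ι : ∀ i, X i ⟶ C),
      IsColimit (Cofan.mk C ι) → (∀ i, P (X i)) → P C) :
    (extensionClosedStructure P).AET4.{w} := by
  have hcl (I : Type w) : P.IsClosedUnderColimitsOfShape (Discrete I) := .mk' (by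
    rintro _ ⟨F, hF⟩
    exact hP I (fun i => F.obj ⟨i⟩) _ (fun i => colimit.ι F ⟨i⟩)
      (IsColimit.ofIsoColimit ((IsColimit.precomposeHomEquiv Discrete.natIsoFunctor.symm _).symm
        (colimit.isColimit F)) (Cofan.ext (Iso.refl _) fun i => by simp [Cofan.inj])) fun i => hF ⟨i⟩)
  have hcolim (I : Type w) : HasColimitsOfShape (Discrete I) P.FullSubcategory :=
    hasColimitsOfShape_of_closedUnderColimits _ _
  have hι {I : Type w} (X : I → P.FullSubcategory) : IsColimit
      (Cofan.mk (f := fun i => (X i).obj) (∐ X).obj fun i => (Limits.Sigma.ι X i).hom) :=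
    isColimitCofanMkObjOfIsColimit P.ι X _ (coproductIsCoproduct X)
  refine ExtriangulatedStructure.aet4_of_unique_of_exists _ hcolim ?_ ?_
  · intro I B A γ γ' h
    exact cofan_hom_ext (hι B) h
  · intro I B A η
    obtain ⟨γ, hγ⟩ := exists_desc (hι B)
      fun i => (η i : (B i).obj ⟶ A.obj⟦(1 : ℤ)⟧) ≫
        (Limits.Sigma.ι (fun _ : I => A) i).hom⟦(1 : ℤ)⟧'
    refine ⟨γ, hγ, fun F x y h => ?_⟩
    exact coproduct_distinguished h (hι _) (hι _) (hι _)
      (fun i => congrArg InducedCategory.Hom.hom (Sigma.ι_map x i))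
      (fun i => congrArg InducedCategory.Hom.hom (Sigma.ι_map y i)) hγ

theorem extensionClosedStructure_aet4Star (hD : HasProducts.{w} D)
    (hP : ∀ (I : Type w) (X : I → D) (C : D) (π : ∀ i, C ⟶ X i),
      IsLimit (Fan.mk C π) → (∀ i, P (X i)) → P C) :
    (extensionClosedStructure P).AET4Star.{w} := by
  have hcl (I : Type w) : P.IsClosedUnderLimitsOfShape (Discrete I) := .mk' (by
    rintro _ ⟨F, hF⟩
    exact hP I (fun i => F.obj ⟨i⟩) _ (fun i => limit.π F ⟨i⟩)
      (IsLimit.ofIsoLimit ((IsLimit.postcomposeHomEquiv Discrete.natIsoFunctor _).symm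
        (limit.isLimit F)) (Fan.ext (Iso.refl _) fun i => by simp [Fan.proj])) fun i => hF ⟨i⟩)
  have hlim (I : Type w) : HasLimitsOfShape (Discrete I) P.FullSubcategory :=
    hasLimitsOfShape_of_closedUnderLimits _ _
  have hcolim (I : Type w) : HasColimitsOfShape (Discrete I) P.FullSubcategoryᵒᵖ :=
    hasCoproductsOfShape_opposite I
  -- Coproducts in the opposite category are products in `D`. Extensions there are morphisms into a
  -- shifted product, which is why `isLimitShift` replaces `hι` alone below.
  have hι {I : Type w} (X : I → P.FullSubcategoryᵒᵖ) : IsLimit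
      (Fan.mk (f := fun i => (X i).unop.obj) (∐ X).unop.obj
        fun i => (Limits.Sigma.ι X i).unop.hom) :=
    isLimitFanMkObjOfIsLimit P.ι _ _ (isLimitUnopCofan (coproductIsCoproduct X))
  refine ExtriangulatedStructure.aet4_of_unique_of_exists _ hcolim ?_ ?_
  · intro I B A γ γ' h
    exact fan_hom_ext (isLimitShift (hι B) 1) h
  · intro I B A η
    obtain ⟨γ, hγ⟩ := exists_lift (isLimitShift (hι B) 1)
      fun i => (Limits.Sigma.ι (fun _ : I => A) i).unop.hom ≫
        (η i : A.unop.obj ⟶ (B i).unop.obj⟦(1 : ℤ)⟧)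
    refine ⟨γ, hγ, fun F x y h => ?_⟩
    exact product_distinguished h (hι _) (hι _) (hι _)
      (fun i => congrArg (fun f => f.unop.hom) (Sigma.ι_map y i))
      (fun i => congrArg (fun f => f.unop.hom) (Sigma.ι_map x i)) hγ

end ExactSums

/-! ### t-structures and coproducts -/

section TStructure

variable (x : TStructure D)

theorem le_of_isColimit {I : Type w} {X : I → D} {C : D} {ι : ∀ i, X i ⟶ C}
    (h : IsColimit (Cofan.mk C ι)) (k : ℤ) (hX : ∀ i, x.le k (X i)) : x.le k C := by
  simp only [TStructure.le_iff_isLE] at hX ⊢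
  rw [x.isLE_iff_orthogonal k (k + 1) rfl]
  intro Y f _
  exact cofan_hom_ext h fun i => by
    rw [comp_zero]
    exact x.zero _ k (k + 1)

theorem ge_of_isLimit {I : Type w} {X : I → D} {C : D} {π : ∀ i, C ⟶ X i}
    (h : IsLimit (Fan.mk C π)) (k : ℤ) (hX : ∀ i, x.ge k (X i)) : x.ge k C := by
  simp only [TStructure.ge_iff_isGE] at hX ⊢
  rw [x.isGE_iff_orthogonal (k - 1) k (by simp)]
  intro Y f _
  exact fan_hom_ext h fun i => by
    rw [zero_comp]
    exact x.zero _ (k - 1) k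

variable {x}

/-- Shifting to degree `0` and back: coproducts lose at most `m` degrees, whatever the starting
degree. -/
theorem NSmashing.ge_of_isColimit {m : ℕ} (hx : NSmashing.{w} x m) {I : Type w} {X : I → D}
    {C : D} {ι : ∀ i, X i ⟶ C} (h : IsColimit (Cofan.mk C ι)) {k l : ℤ} (hl : l + m = k)
    (hX : ∀ i, x.ge k (X i)) : x.ge l C := by
  have : x.IsGE (C⟦k⟧) (-(m : ℤ)) :=
    ⟨hx _ ⟨I, _, _, fun i => x.ge_shift k k 0 (by simp) _ (hX i), ⟨isColimitShift h k⟩⟩⟩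
  exact (x.isGE_of_shift C l k (-(m : ℤ))).ge

theorem NCoSmashing.le_of_isLimit {m : ℕ} (hx : NCoSmashing.{w} x m) {I : Type w} {X : I → D}
    {C : D} {π : ∀ i, C ⟶ X i} (h : IsLimit (Fan.mk C π)) {k l : ℤ} (hl : k + m = l)
    (hX : ∀ i, x.le k (X i)) : x.le l C := by
  have : x.IsLE (C⟦k⟧) (m : ℤ) :=
    ⟨hx _ ⟨I, _, _, fun i => x.le_shift k k 0 (by simp) _ (hX i), ⟨isLimitShift h k⟩⟩⟩
  exact (x.isLE_of_shift C l k (m : ℤ)).le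

theorem ge_of_dist {A F B : D} {f : A ⟶ F} {g : F ⟶ B} {δ : B ⟶ A⟦(1 : ℤ)⟧}
    (h : Triangle.mk f g δ ∈ distTriang D) {k : ℤ} (hA : x.ge k A) (hB : x.ge k B) : x.ge k F :=
  (x.isGE₂ _ h k ⟨hA⟩ ⟨hB⟩).ge

theorem le_of_dist {A F B : D} {f : A ⟶ F} {g : F ⟶ B} {δ : B ⟶ A⟦(1 : ℤ)⟧}
    (h : Triangle.mk f g δ ∈ distTriang D) {k : ℤ} (hA : x.le k A) (hB : x.le k B) : x.le k F :=
  (x.isLE₂ _ h k ⟨hA⟩ ⟨hB⟩).le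

/-- With `F` zero, `A` is `B⟦-1⟧` up to isomorphism; the inverse rotation lets closure under
extensions give the bound directly. -/
theorem ge_of_dist_of_isZero {A F B : D} {f : A ⟶ F} {g : F ⟶ B} {δ : B ⟶ A⟦(1 : ℤ)⟧}
    (h : Triangle.mk f g δ ∈ distTriang D) (hF : IsZero F) {k : ℤ} (hB : x.ge k B) :
    x.ge (k + 1) A :=
  ge_of_dist (inv_rot_of_distTriang _ h) (x.ge_shift k (-1) (k + 1) (by simp) _ hB)
    (x.isGE_of_isZero hF _).ge

theorem le_of_dist_of_isZero {A F B : D} {f : A ⟶ F} {g : F ⟶ B} {δ : B ⟶ A⟦(1 : ℤ)⟧}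
    (h : Triangle.mk f g δ ∈ distTriang D) (hF : IsZero F) {k : ℤ} (hA : x.le k A) :
    x.le (k - 1) B :=
  le_of_dist (rot_of_distTriang _ h) (x.isLE_of_isZero hF _).le
    (x.le_shift k 1 (k - 1) (by simp) _ hA)

/-- Truncation triangles, with the bounds which the truncations inherit from the object. -/
theorem exists_truncation {k : ℤ} {A : D} {a b : ℤ} (hak : a ≤ k)
    (hkb : k ≤ b + 1) (hA : x.ge a A) (hA' : x.le b A) :
    ∃ (X Y : D) (f : X ⟶ A) (g : A ⟶ Y) (δ : Y ⟶ X⟦(1 : ℤ)⟧),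
      Triangle.mk f g δ ∈ distTriang D ∧ x.ge a X ∧ x.le (k - 1) X ∧ x.ge k Y ∧ x.le b Y := by
  obtain ⟨X, Y, hX, hY, f, g, δ, h⟩ := x.exists_triangle A (k - 1) k (by simp)
  exact ⟨X, Y, f, g, δ, h, ge_of_dist (inv_rot_of_distTriang _ h)
      (x.ge_antitone (by lia) _ (x.ge_shift k (-1) (k + 1) (by simp) _ hY)) hA, hX, hY,
    le_of_dist (rot_of_distTriang _ h) hA'
      (x.le_monotone (by lia) _ (x.le_shift (k - 1) 1 (k - 2) (by lia) _ hX))⟩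

theorem isZero_of_le_of_ge {A : D} {a b : ℤ} (hA : x.le a A) (hA' : x.ge b A) (hab : a < b) :
    IsZero A :=
  have : x.IsLE A a := ⟨hA⟩
  have : x.IsGE A b := ⟨hA'⟩
  x.isZero A a b hab

theorem ge_of_retract {A B : D} (s : A ⟶ B) (r : B ⟶ A) (h : s ≫ r = 𝟙 A) {k : ℤ}
    (hB : x.ge k B) : x.ge k A := by
  simp only [TStructure.ge_iff_isGE] at hB ⊢
  rw [x.isGE_iff_orthogonal (k - 1) k (by simp)]
  intro Y f _
  rw [← comp_id f, ← h, ← assoc, x.zero (f ≫ s) (k - 1) k, zero_comp]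

theorem le_of_retract {A B : D} (s : A ⟶ B) (r : B ⟶ A) (h : s ≫ r = 𝟙 A) {k : ℤ}
    (hB : x.le k B) : x.le k A := by
  simp only [TStructure.le_iff_isLE] at hB ⊢
  rw [x.isLE_iff_orthogonal k (k + 1) rfl]
  intro Y f _
  rw [← id_comp f, ← h, assoc, x.zero (r ≫ f) k (k + 1), comp_zero]

end TStructure

end

end Extri

namespace Extri

section ExtendedHeart

open scoped ZeroObject

variable {D : Type u} [Category.{v} D] [Preadditive D] [HasZeroObject D] [HasShift D ℤ]
  [∀ n : ℤ, (shiftFunctor D n).Additive] [Pretriangulated D] [IsTriangulated D]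
  {x : TStructure D} {n : ℕ}

/-! ### From AET3.5 to the smashing condition -/

/-- The engine of the converse: AET3.5 applied to `A ⟶ 0 ⟶ ΣA` forces the suspension of the
coproduct to stay in the extended heart, which gains one degree. -/
theorem ge_one_of_aet35 (h : (extendedHeartStructure x n).AET35.{w}) {A C : D} {I : Type w}
    [Nonempty I] {ι : I → (A ⟶ C)} (hC : IsColimit (Cofan.mk C ι)) (hA : x.ge 1 A)
    (hA' : x.le ((n : ℤ) - 1) A) (hC₀ : x.ge 0 C) : x.ge 1 C := by
  let A₀ : (extendedHeart x n).FullSubcategory := ⟨A, x.ge_antitone zero_le_one _ hA, hA'⟩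
  let B₀ : (extendedHeart x n).FullSubcategory :=
    ⟨A⟦(1 : ℤ)⟧, x.ge_shift 1 1 0 rfl _ hA, x.le_monotone (by lia : (n : ℤ) - 1 - 1 ≤ n - 1) _
      (x.le_shift _ 1 _ (by lia) _ hA')⟩
  let Z₀ : (extendedHeart x n).FullSubcategory :=
    ⟨0, (x.isGE_of_isZero (isZero_zero D) 0).ge, (x.isLE_of_isZero (isZero_zero D) _).le⟩
  let C₀ : (extendedHeart x n).FullSubcategory := ⟨C, hC₀, le_of_isColimit x hC _ fun _ => hA'⟩
  have hZ₀ : IsZero Z₀ := (IsZero.iff_id_eq_zero _).2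
    (ObjectProperty.hom_ext _ ((isZero_zero D).eq_of_src _ _))
  obtain ⟨A', F', B', a, b, γ, x', y', ⟨ha⟩, -, hF', hγ⟩ :=
    ExtriangulatedStructure.AET35.exists_realizes_of_isZero h
      (A := A₀) (F := Z₀) (B := B₀) (δ := 𝟙 (A⟦(1 : ℤ)⟧)) (x := ObjectProperty.homMk 0)
      (y := ObjectProperty.homMk 0) (contractible_distinguished₂ A) hZ₀ I
  -- The bound `hC₀` puts `C` in the extended heart, so it is also the coproduct there and agrees
  -- with `A'`.
  have hC' : IsColimit (Cofan.mk (f := fun _ => A₀) C₀ fun i => ObjectProperty.homMk (ι i)) :=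
    isColimitFullCofan _ hC
  let e := (extendedHeart x n).ι.mapIso (ha.coconePointUniqueUpToIso hC')
  exact (x.ge 1).prop_of_iso e
    (ge_of_dist_of_isZero hγ ((extendedHeart x n).ι.map_isZero hF') B'.property.1)

/-- Dual gain at the upper end of the window, from the sequence `B⟦-1⟧ ⟶ 0 ⟶ B`. -/
theorem le_of_aet35Star (h : (extendedHeartStructure x n).AET35Star.{w}) {B C : D} {I : Type w}
    [Nonempty I] {π : I → (C ⟶ B)} (hC : IsLimit (Fan.mk C π)) (hB : x.ge 0 B)
    (hB' : x.le ((n : ℤ) - 2) B) (hC₀ : x.le ((n : ℤ) - 1) C) : x.le ((n : ℤ) - 2) C := by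
  let B₀ : (extendedHeart x n).FullSubcategory := ⟨B, hB, x.le_monotone (by lia) _ hB'⟩
  let A₀ : (extendedHeart x n).FullSubcategory :=
    ⟨B⟦(-1 : ℤ)⟧, x.ge_antitone zero_le_one _ (x.ge_shift 0 (-1) 1 rfl _ hB),
      x.le_shift _ (-1) _ (by lia) _ hB'⟩
  let Z₀ : (extendedHeart x n).FullSubcategory :=
    ⟨0, (x.isGE_of_isZero (isZero_zero D) 0).ge, (x.isLE_of_isZero (isZero_zero D) _).le⟩
  let C₀ : (extendedHeart x n).FullSubcategory := ⟨C, ge_of_isLimit x hC _ fun _ => hB, hC₀⟩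
  have hZ₀ : IsZero Z₀ := (IsZero.iff_id_eq_zero _).2
    (ObjectProperty.hom_ext _ ((isZero_zero D).eq_of_src _ _))
  obtain ⟨δ, hδ⟩ := dist_shift_neg_one B
  obtain ⟨A', F', B', a, b, γ, x', y', ⟨ha⟩, -, hF', hγ⟩ :=
    ExtriangulatedStructure.AET35.exists_realizes_of_isZero h
      (A := op B₀) (F := op Z₀) (B := op A₀) (δ := δ)
      (x := (ObjectProperty.homMk 0 : Z₀ ⟶ B₀).op)
      (y := (ObjectProperty.homMk 0 : A₀ ⟶ Z₀).op) hδ hZ₀.op I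
  have hC' : IsLimit (Fan.mk (f := fun _ => B₀) C₀ fun i => ObjectProperty.homMk (π i)) :=
    isLimitFullFan _ hC
  let e := (extendedHeart x n).ι.mapIso ((isLimitUnopCofan ha).conePointUniqueUpToIso hC')
  have := le_of_dist_of_isZero hγ ((extendedHeart x n).ι.map_isZero hF'.unop) B'.unop.property.2
  exact (x.le _).prop_of_iso e (by simpa [sub_sub] using this)

/-- Descending induction on the defect `m`, which is at most `n - 1` by hypothesis on `x`. -/
theorem ge_zero_of_aet35_of_heart (h : (extendedHeartStructure x n).AET35.{w})
    (hx : NSmashing.{w} x (n - 1)) {I : Type w} [Nonempty I] (hn : 1 ≤ n) {M C : D}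
    {ι : I → (M ⟶ C)} (hC : IsColimit (Cofan.mk C ι)) (hM : x.ge 0 M) (hM' : x.le 0 M) :
    x.ge 0 C := by
  suffices ∀ m : ℕ, m + 1 ≤ n → x.ge (-(m : ℤ)) C → x.ge 0 C from
    this (n - 1) (by lia) (hx.ge_of_isColimit hC (by lia) fun _ => hM)
  intro m hm hm'
  induction m with
  | zero => simpa using hm'
  | succ m ih =>
    refine ih (by lia) ?_
    -- This shift moves `C` to degrees `≥ 0` and `M` to degree `m + 1`, which lies in `[1, n-1]`.
    have := ge_one_of_aet35 h (isColimitShift hC (-((m + 1 : ℕ) : ℤ)))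
      (x.ge_antitone (by lia) _ (x.ge_shift 0 (-((m + 1 : ℕ) : ℤ)) (m + 1 : ℕ) (by lia) _ hM))
      (x.le_monotone (by lia) _ (x.le_shift 0 (-((m + 1 : ℕ) : ℤ)) (m + 1 : ℕ) (by lia) _ hM'))
      (x.ge_shift _ _ 0 (by lia) _ hm')
    have : x.IsGE (C⟦(-((m + 1 : ℕ) : ℤ))⟧) 1 := ⟨this⟩
    exact (x.isGE_of_shift C _ (-((m + 1 : ℕ) : ℤ)) 1 (by lia)).ge

theorem le_of_aet35Star_of_heart (h : (extendedHeartStructure x n).AET35Star.{w})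
    (hx : NCoSmashing.{w} x (n - 1)) {I : Type w} [Nonempty I] (hn : 1 ≤ n) {M C : D}
    {π : I → (C ⟶ M)} (hC : IsLimit (Fan.mk C π)) (hM : x.ge 0 M) (hM' : x.le 0 M) :
    x.le 0 C := by
  suffices ∀ m : ℕ, m + 1 ≤ n → x.le (m : ℤ) C → x.le 0 C from
    this (n - 1) (by lia) (hx.le_of_isLimit hC (by lia) fun _ => hM')
  intro m hm hm'
  induction m with
  | zero => simpa using hm'
  | succ m ih =>
    refine ih (by lia) ?_
    -- This shift moves `C` to degrees `≤ n - 1` and `M` to degree `n - 2 - m`, which lies in `[0,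
    -- n-2]`.
    have := le_of_aet35Star h (isLimitShift hC (m + 2 - n))
      (x.ge_antitone (by lia) _ (x.ge_shift 0 _ (n - 2 - m) (by lia) _ hM))
      (x.le_monotone (by lia) _ (x.le_shift 0 _ (n - 2 - m) (by lia) _ hM'))
      (x.le_shift _ _ _ (by push_cast; lia) _ hm')
    have : x.IsLE (C⟦((m : ℤ) + 2 - n)⟧) ((n : ℤ) - 2) := ⟨this⟩
    exact (x.isLE_of_shift C _ ((m : ℤ) + 2 - n) ((n : ℤ) - 2) (by lia)).le

/-- Dévissage on the number of degrees: each step splits off the top one, a shifted heart object, by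
a truncation triangle and takes coproducts. -/
theorem ge_zero_of_aet35_of_const (hD : HasCoproducts.{w} D)
    (h : (extendedHeartStructure x n).AET35.{w}) (hx : NSmashing.{w} x (n - 1)) (hn : 1 ≤ n)
    {I : Type w} [Nonempty I] {A : D} (hA : extendedHeart x n A) :
    x.ge 0 (∐ fun _ : I => A) := by
  suffices ∀ k : ℕ, k ≤ n → ∀ A : D, x.ge 0 A → x.le ((k : ℤ) - 1) A →
    x.ge 0 (∐ fun _ : I => A) from this n le_rfl A hA.1 hA.2
  intro k
  induction k with
  | zero =>
    intro _ A hA hA'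
    -- Here `A` is zero, so it satisfies every lower bound; `n - 1` compensates exactly for the
    -- loss.
    exact hx.ge_of_isColimit (coproductIsCoproduct _) (k := (n - 1 : ℕ)) (by lia) fun _ =>
      (x.isGE_of_isZero (isZero_of_le_of_ge hA' hA (by simp)) _).ge
  | succ k ih =>
    intro hk A hA hA'
    obtain ⟨X, Y, f, g, δ, hT, hX, hX', hY, hY'⟩ :=
      exists_truncation (k := k) (by lia) (by lia) hA hA'
    obtain ⟨γ, hγ⟩ := exists_dist_sigma fun _ : I => hT
    refine ge_of_dist hγ (ih (by lia) X hX hX') (x.ge_antitone (by lia : 0 ≤ (k : ℤ)) _ ?_)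
    have : x.IsGE ((∐ fun _ : I => Y)⟦(k : ℤ)⟧) 0 := ⟨ge_zero_of_aet35_of_heart h hx hn
      (isColimitShift (coproductIsCoproduct _) k) (x.ge_shift k k 0 (by simp) _ hY)
      (x.le_shift k k 0 (by simp) _ (by simpa using hY'))⟩
    exact (x.isGE_of_shift _ k k 0).ge

/-- Here the window grows downwards from `n - 1`, and the lowest degree is split off. -/
theorem le_of_aet35Star_of_const (hD : HasProducts.{w} D)
    (h : (extendedHeartStructure x n).AET35Star.{w}) (hx : NCoSmashing.{w} x (n - 1))
    (hn : 1 ≤ n) {I : Type w} [Nonempty I] {A : D} (hA : extendedHeart x n A) :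
    x.le ((n : ℤ) - 1) (∏ᶜ fun _ : I => A) := by
  suffices ∀ k : ℕ, k ≤ n → ∀ A : D, x.ge ((n : ℤ) - k) A → x.le ((n : ℤ) - 1) A →
    x.le ((n : ℤ) - 1) (∏ᶜ fun _ : I => A) from this n le_rfl A (by simpa using hA.1) hA.2
  intro k
  induction k with
  | zero =>
    intro _ A hA hA'
    exact hx.le_of_isLimit (productIsProduct _) (k := 0) (by lia) fun _ =>
      (x.isLE_of_isZero (isZero_of_le_of_ge hA' hA (by simp)) _).le
  | succ k ih =>
    intro hk A hA hA'
    obtain ⟨X, Y, f, g, δ, hT, hX, hX', hY, hY'⟩ :=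
      exists_truncation (k := n - k) (by lia) (by lia) hA hA'
    obtain ⟨γ, hγ⟩ := exists_dist_pi fun _ : I => hT
    refine le_of_dist hγ
      (x.le_monotone (by lia : (n : ℤ) - (k + 1 : ℕ) ≤ n - 1) _ ?_) (ih (by lia) Y hY hY')
    have : x.IsLE ((∏ᶜ fun _ : I => X)⟦(n : ℤ) - (k + 1 : ℕ)⟧) 0 :=
      ⟨le_of_aet35Star_of_heart h hx hn
        (isLimitShift (productIsProduct _) _) (x.ge_shift _ _ 0 (by simp) _ hX)
        (x.le_shift _ _ 0 (by lia) _ hX')⟩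
    exact (x.isLE_of_shift _ _ ((n : ℤ) - (k + 1 : ℕ)) 0).le

theorem nsmashing_zero_of_aet35 (hD : HasCoproducts.{w} D)
    (h : (extendedHeartStructure x n).AET35.{w}) (hx : NSmashing.{w} x (n - 1)) (hn : 1 ≤ n) :
    NSmashing.{w} x 0 := by
  rintro C ⟨I, X, ι, hX, ⟨hC⟩⟩
  rw [Nat.cast_zero, neg_zero]
  -- AET3.5 concerns only non-empty families; the empty coproduct is zero.
  cases isEmpty_or_nonempty I
  · exact (x.isGE_of_isZero ((IsZero.iff_id_eq_zero _).2 (cofan_hom_ext hC isEmptyElim)) 0).ge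
  refine (x.ge 0).prop_of_iso ((coproductIsCoproduct X).coconePointUniqueUpToIso hC) ?_
  -- The cut leaves `L i` in the extended heart and `G i` high enough to survive the loss of `n - 1`
  -- degrees.
  have hT (i) := x.exists_triangle (X i) (n - 1) n (by simp)
  choose L G hL hG f g δ hT using hT
  obtain ⟨γ, hγ⟩ := exists_dist_sigma hT
  refine ge_of_dist hγ ?_ (hx.ge_of_isColimit (coproductIsCoproduct G) (by lia) fun i =>
    x.ge_antitone (by lia : ((n - 1 : ℕ) : ℤ) ≤ n) _ (hG i))
  have hL' (i) : extendedHeart x n (L i) := ⟨ge_of_dist (inv_rot_of_distTriang _ (hT i))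
      (x.ge_antitone (by lia) _ (x.ge_shift n (-1) (n + 1) (by simp) _ (hG i))) (hX i), hL i⟩
  -- The coproduct of the `L i` in `D` becomes a retract of a coproduct of copies of the one object
  -- `A`.
  obtain ⟨A, s, r, hsr⟩ := ExtriangulatedStructure.AET35.exists_retract h
    fun i => (⟨L i, hL' i⟩ : (extendedHeart x n).FullSubcategory)
  refine ge_of_retract (Limits.Sigma.map fun i => (s i).hom) (Limits.Sigma.map fun i => (r i).hom)
    (Sigma.hom_ext _ _ fun i => ?_)
    (ge_zero_of_aet35_of_const hD h hx hn A.property)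
  have := congrArg InducedCategory.Hom.hom (hsr i)
  dsimp at this
  simp [reassoc_of% this]

theorem ncoSmashing_zero_of_aet35Star (hD : HasProducts.{w} D)
    (h : (extendedHeartStructure x n).AET35Star.{w}) (hx : NCoSmashing.{w} x (n - 1))
    (hn : 1 ≤ n) : NCoSmashing.{w} x 0 := by
  rintro C ⟨I, X, π, hX, ⟨hC⟩⟩
  rw [Nat.cast_zero]
  cases isEmpty_or_nonempty I
  · exact (x.isLE_of_isZero ((IsZero.iff_id_eq_zero _).2 (fan_hom_ext hC isEmptyElim)) 0).le
  -- The shift aligns the upper bound with the top of the extended heart, so that truncation at `0`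
  -- leaves `G i` inside it and `L i` below.
  have hXs (i) : x.le ((n : ℤ) - 1) ((X i)⟦(1 - n : ℤ)⟧) := x.le_shift _ _ _ (by lia) _ (hX i)
  suffices x.le ((n : ℤ) - 1) (∏ᶜ fun i => (X i)⟦(1 - n : ℤ)⟧) by
    have : x.IsLE (C⟦(1 - n : ℤ)⟧) ((n : ℤ) - 1) := ⟨(x.le _).prop_of_iso
      ((productIsProduct _).conePointUniqueUpToIso (isLimitShift hC (1 - n))) this⟩
    exact (x.isLE_of_shift C 0 (1 - n) ((n : ℤ) - 1)).le
  have hT (i) := x.exists_triangle ((X i)⟦(1 - n : ℤ)⟧) (-1) 0 (by simp)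
  choose L G hL hG f g δ hT using hT
  obtain ⟨γ, hγ⟩ := exists_dist_pi hT
  refine le_of_dist hγ (hx.le_of_isLimit (productIsProduct L) (by lia) fun i =>
    x.le_monotone (by lia : -1 ≤ (0 : ℤ)) _ (hL i)) ?_
  have hG' (i) : extendedHeart x n (G i) := ⟨hG i, le_of_dist (rot_of_distTriang _ (hT i))
    (hXs i) (x.le_monotone (by lia) _ (x.le_shift (-1) 1 (-2) (by simp) _ (hL i)))⟩
  obtain ⟨A, s, r, hsr⟩ := ExtriangulatedStructure.AET35.exists_retract h
    fun i => op (⟨G i, hG' i⟩ : (extendedHeart x n).FullSubcategory)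
  refine le_of_retract (Limits.Pi.map fun i => (r i).unop.hom)
    (Limits.Pi.map fun i => (s i).unop.hom) (Pi.hom_ext _ _ fun i => ?_)
    (le_of_aet35Star_of_const hD h hx hn A.unop.property)
  have := congrArg (fun f => f.unop.hom) (hsr i)
  dsimp at this
  simp [this]

end ExtendedHeart

end Extri

/-! ### The main theorem -/

theorem mainTheorem3 {D : Type u} [Category.{v} D] [Preadditive D] [HasZeroObject D]
    [HasShift D ℤ] [∀ k : ℤ, (shiftFunctor D k).Additive] [Pretriangulated D] [IsTriangulated D]
    (x : TStructure D) (n : ℕ) (hn : 2 ≤ n) :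
    (HasCoproducts.{w} D → Extri.NSmashing.{w} x (n - 1) →
      List.TFAE [
        Extri.NSmashing.{w} x 0,
        (Extri.extendedHeartStructure x n).AET4.{w},
        (Extri.extendedHeartStructure x n).AET35.{w}]) ∧
    (HasProducts.{w} D → Extri.NCoSmashing.{w} x (n - 1) →
      List.TFAE [
        Extri.NCoSmashing.{w} x 0,
        (Extri.extendedHeartStructure x n).AET4Star.{w},
        (Extri.extendedHeartStructure x n).AET35Star.{w}]) := by
  refine ⟨fun hD hx => ?_, fun hD hx => ?_⟩
  · tfae_have 1 → 2 := fun h => Extri.extensionClosedStructure_aet4 _ hD fun _ _ _ _ hC hX =>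
      ⟨h.ge_of_isColimit hC (by simp) fun i => (hX i).1,
        Extri.le_of_isColimit x hC _ fun i => (hX i).2⟩
    tfae_have 2 → 3 := fun h => h.aet35
    tfae_have 3 → 1 := fun h => Extri.nsmashing_zero_of_aet35 hD h hx (by lia)
    tfae_finish
  · tfae_have 1 → 2 := fun h => Extri.extensionClosedStructure_aet4Star _ hD fun _ _ _ _ hC hX =>
      ⟨Extri.ge_of_isLimit x hC _ fun i => (hX i).1,
        h.le_of_isLimit hC (by simp) fun i => (hX i).2⟩
    tfae_have 2 → 3 := Extri.ExtriangulatedStructure.AET4.aet35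
    tfae_have 3 → 1 := fun h => Extri.ncoSmashing_zero_of_aet35Star hD h hx (by lia)
    tfae_finish
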